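/- **Setting.** Let $(X,\|\cdot\|)$ be a real Banach space and let $\{L(t,\tau)\}_{t\ge\tau}\subset\mathcal L(X)$ be a linear evolution process: $L(t,t)=I$, $L(t,\tau)=L(t,s)L(s,\tau)$ for $t\ge s\ge\tau$, and $(t,\tau)\mapsto L(t,\tau)\eta$ is continuous on $\{t\ge\tau\}$ for every $\eta\in X$. Assume that it has an exponential splitting with bound $M\ge1$, exponents $\gamma>\rho$ and projections $Q(t)\in\mathcal L(X)$, $t\in\mathbb R$. That is, $Q(t)L(t,\tau)=L(t,\tau)Q(\tau)$ for $t\ge\tau$; for $t\ge\tau$ the operator $L(t,\tau)$ is an isomorphism of $N(\tau)=Q(\tau)X$ onto $N(t)$, whose inverse is denoted $L(\tau,t)$; and $$e^{\gamma(t-\tau)}\|L(t,\tau)(I-Q(\tau))\|\le M\ (t\ge\tau),\qquad e^{\rho(t-\tau)}\|L(t,\tau)Q(\tau)\|\le M\ (t\le\tau).$$ Put $|x|_{N(\tau)}=\sup_{t\le\tau}e^{\rho(t-\tau)}\|L(t,\tau)x\|$ for $x\in N(\tau)$ and $|x|_{S(\tau)}=\sup_{t\ge\tau}e^{\gamma(t-\tau)}\|L(t,\tau)x\|$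 for $x\in S(\tau)=(I-Q(\tau))X$. Let $\Gamma$ be a norm on $\mathbb R^2$ such that $\Gamma(a,\cdot)$ and $\Gamma(\cdot,b)$ are nondecreasing on $[0,\infty)$ for all $a,b\ge0$, and put $\|x\|_\tau=\Gamma(|Q(\tau)x|_{N(\tau)},|(I-Q(\tau))x|_{S(\tau)})$. Let $f:\mathbb R\times X\to X$ be continuous with $f(t,0)=0$ for all $t$ and, for some $L_1,L_2>0$ and all $t\in\mathbb R$, $u,v\in X$, $$|Q(t)(f(t,u)-f(t,v))|_{N(t)}\le L_1\|u-v\|_t,\qquad |(I-Q(t))(f(t,u)-f(t,v))|_{S(t)}\le L_2\|u-v\|_t .$$ Let $\sigma\in(\rho,\gamma)$ satisfy $\Gamma\big(\tfrac{L_1}{\sigma-\rho},\tfrac{L_2}{\gamma-\sigma}\big)<1$. Finally, assume that $f(t,\cdot)$ is Fréchet differentiable on $X$ for every $t$, with derivative $Df(t,u)\in\mathcal L(X)$. For $\tau\in\mathbb R$ let $E_{\sigma,\tau}$ be the space of continuous $z:(-\infty,\tau]\to X$ with $\sup_{t\le\tau}e^{\sigma(t-\tau)}\|z(t)\|_t<\infty$,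 and let $F_{\sigma,\tau}$ be the space of strongly continuous $Z:(-\infty,\tau]\to\mathcal L(X)$ with $$\|Z\|_{F_{\sigma,\tau}}=\sup_{t\le\tau}\sup_{\|w\|\le1}e^{\sigma(t-\tau)}\|Z(t)w\|_t<\infty.$$ Integrals of operator-valued functions are strong integrals: $\int G(s)\,ds$ is the bounded operator $w\mapsto\int G(s)w\,ds$. **Theorem.** (a) For all $\tau\in\mathbb R$ and $\eta\in X$ there is exactly one $z_{\tau,\eta}\in E_{\sigma,\tau}$ with $$z_{\tau,\eta}(t)=L(t,\tau)Q(\tau)\eta-\int_t^\tau L(t,s)Q(s)f(s,z_{\tau,\eta}(s))\,ds+\int_{-\infty}^tL(t,s)(I-Q(s))f(s,z_{\tau,\eta}(s))\,ds,\quad t\le\tau .$$ The function $\Sigma(\tau,\eta):=(I-Q(\tau))z_{\tau,\eta}(\tau)$ satisfies $$\Sigma(\tau,\eta)=\int_{-\infty}^\tau L(\tau,s)(I-Q(s))f(s,z_{\tau,\eta}(s))\,ds .$$ (b) For every $\tau\in\mathbb R$ the map $\Sigma(\tau,\cdot):X\to X$ is Fréchet differentiable. For every $t\le\tau$ the map $\eta\mapsto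 z_{\tau,\eta}(t)$ is Fréchet differentiable. For all $\tau\in\mathbb R$ and $\eta\in X$, $$D_\eta\Sigma(\tau,\eta)=\int_{-\infty}^\tau L(\tau,s)(I-Q(s))\,Df(s,z_{\tau,\eta}(s))\,D_\eta[z_{\tau,\eta}(s)]\,ds .$$ (c) For all $\tau\in\mathbb R$ and $\eta\in X$ the formula $$(J_{\tau,\eta}Z)(t)=L(t,\tau)Q(\tau)-\int_t^\tau L(t,s)Q(s)Df(s,z_{\tau,\eta}(s))Z(s)\,ds+\int_{-\infty}^tL(t,s)(I-Q(s))Df(s,z_{\tau,\eta}(s))Z(s)\,ds,\quad t\le\tau,$$ defines a map of $F_{\sigma,\tau}$ into itself (all the integrals exist), and $$\|J_{\tau,\eta}Z-J_{\tau,\eta}\tilde Z\|_{F_{\sigma,\tau}}\le\Gamma\Big(\tfrac{L_1}{\sigma-\rho},\tfrac{L_2}{\gamma-\sigma}\Big)\|Z-\tilde Z\|_{F_{\sigma,\tau}}\quad\text{for all }Z,\tilde Z\in F_{\sigma,\tau}.$$ Its unique fixed point in $F_{\sigma,\tau}$ is $t\mapsto D_\eta[z_{\tau,\eta}(t)]$.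 -/

import Mathlib

open MeasureTheory Set

noncomputable section

namespace InertialManifold

variable {X : Type*} [NormedAddCommGroup X] [NormedSpace ℝ X]

/-- A linear evolution process. Only the operators `L t τ` with `τ ≤ t` are meaningful. -/
structure IsLinearEvolutionProcess (L : ℝ → ℝ → X →L[ℝ] X) : Prop where
  comp : ∀ τ s t : ℝ, τ ≤ s → s ≤ t → L t τ = (L t s) ∘L (L s τ)
  refl : ∀ t : ℝ, L t t = ContinuousLinearMap.id ℝ X
  strong_cont : ∀ η : X, ContinuousOn (fun p : ℝ × ℝ => L p.1 p.2 η) {p | p.2 ≤ p.1}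

/-- The complementary projection `I - Q(t)`. -/
def complProj (Q : ℝ → X →L[ℝ] X) (t : ℝ) : X →L[ℝ] X :=
  ContinuousLinearMap.id ℝ X - Q t

/-- The operator `L(t,τ)`, `τ ≤ t`, regarded as an operator from `N(τ) = Q(τ)X` to `N(t) = Q(t)X`.
(The projection onto `N(t)` only adjusts the codomain: if `Q(t)L(t,τ) = L(t,τ)Q(τ)`,
then `L(t,τ)` maps `N(τ)` into `N(t)`.) -/
def unstableRestrict (L : ℝ → ℝ → X →L[ℝ] X) (Q : ℝ → X →L[ℝ] X) (t τ : ℝ) :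
    (Q τ).range →L[ℝ] (Q t).range :=
  (Q t).rangeRestrict ∘L (L t τ) ∘L (Q τ).range.subtypeL

/-- The operator `L(t,τ)Q(τ)` for all real `t` and `τ`; if `t < τ` then `L(t,τ) : N(τ) → N(t)`
is the inverse of `L(τ,t) : N(t) → N(τ)`. -/
def unstableOp (L : ℝ → ℝ → X →L[ℝ] X) (Q : ℝ → X →L[ℝ] X) (t τ : ℝ) : X →L[ℝ] X :=
  if τ ≤ t then (L t τ) ∘L (Q τ)
  else (Q t).range.subtypeL ∘L (unstableRestrict L Q τ t).inverse ∘L (Q τ).rangeRestrict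

/-- Exponential splitting with bound `M`, exponents `γ > ρ` and projections `Q`. -/
structure HasExponentialSplitting (L : ℝ → ℝ → X →L[ℝ] X) (Q : ℝ → X →L[ℝ] X)
    (M γ ρ : ℝ) : Prop where
  one_le : 1 ≤ M
  exponents : ρ < γ
  proj : ∀ t : ℝ, (Q t) ∘L (Q t) = Q t
  commute : ∀ τ t : ℝ, τ ≤ t → (Q t) ∘L (L t τ) = (L t τ) ∘L (Q τ)
  iso : ∀ τ t : ℝ, τ ≤ t → (unstableRestrict L Q t τ).IsInvertible
  stable_bound : ∀ τ t : ℝ, τ ≤ t →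
    Real.exp (γ * (t - τ)) * ‖(L t τ) ∘L (complProj Q τ)‖ ≤ M
  unstable_bound : ∀ τ t : ℝ, t ≤ τ →
    Real.exp (ρ * (t - τ)) * ‖unstableOp L Q t τ‖ ≤ M

/-- The norm `|x|_{N(τ)} = sup_{t ≤ τ} e^{ρ(t-τ)} ‖L(t,τ)x‖` of `x ∈ N(τ)`
(for such `x` one has `L(t,τ)x = L(t,τ)Q(τ)x`). -/
def normN (L : ℝ → ℝ → X →L[ℝ] X) (Q : ℝ → X →L[ℝ] X) (ρ τ : ℝ) (x : X) : ℝ :=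
  ⨆ t : Iic τ, Real.exp (ρ * (t - τ)) * ‖unstableOp L Q t τ x‖

/-- The norm `|x|_{S(τ)} = sup_{t ≥ τ} e^{γ(t-τ)} ‖L(t,τ)x‖` of `x ∈ S(τ) = (I - Q(τ))X`. -/
def normS (L : ℝ → ℝ → X →L[ℝ] X) (γ τ : ℝ) (x : X) : ℝ :=
  ⨆ t : Ici τ, Real.exp (γ * (t - τ)) * ‖L t τ x‖

/-- A norm on `ℝ²` which is monotone in each variable on the nonnegative quadrant. -/
structure IsAdmissible (Γ : Seminorm ℝ (ℝ × ℝ)) : Prop where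
  definite : ∀ p : ℝ × ℝ, Γ p = 0 → p = 0
  mono_right : ∀ a : ℝ, 0 ≤ a → MonotoneOn (fun b => Γ (a, b)) (Ici 0)
  mono_left : ∀ b : ℝ, 0 ≤ b → MonotoneOn (fun a => Γ (a, b)) (Ici 0)

/-- The norm `‖x‖_τ = Γ(|Q(τ)x|_{N(τ)}, |(I-Q(τ))x|_{S(τ)})`. -/
def movingNorm (L : ℝ → ℝ → X →L[ℝ] X) (Q : ℝ → X →L[ℝ] X) (Γ : Seminorm ℝ (ℝ × ℝ))
    (γ ρ τ : ℝ) (x : X) : ℝ :=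
  Γ (normN L Q ρ τ (Q τ x), normS L γ τ (complProj Q τ x))

/-- Membership in `E_{σ,τ}`: `z` is continuous on `(-∞,τ]` and
`sup_{t ≤ τ} e^{σ(t-τ)} ‖z(t)‖_t < ∞`. Values of `z` on `(τ,∞)` are irrelevant. -/
def MemE (L : ℝ → ℝ → X →L[ℝ] X) (Q : ℝ → X →L[ℝ] X) (Γ : Seminorm ℝ (ℝ × ℝ))
    (γ ρ σ τ : ℝ) (z : ℝ → X) : Prop :=
  ContinuousOn z (Iic τ) ∧
    BddAbove (range fun t : Iic τ =>
      Real.exp (σ * (t - τ)) * movingNorm L Q Γ γ ρ t (z t))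

/-- The Lyapunov–Perron map `H_{τ,η}`, at times `t ≤ τ`. -/
def lpMap (L : ℝ → ℝ → X →L[ℝ] X) (Q : ℝ → X →L[ℝ] X) (f : ℝ → X → X)
    (τ : ℝ) (η : X) (z : ℝ → X) (t : ℝ) : X :=
  unstableOp L Q t τ η - (∫ s in Ioc t τ, unstableOp L Q t s (f s (z s)))
    + ∫ s in Iic t, L t s (complProj Q s (f s (z s)))

/-- `z` is a fixed point of `H_{τ,η}` in `E_{σ,τ}`. -/
def IsLPFixedPoint (L : ℝ → ℝ → X →L[ℝ] X) (Q : ℝ → X →L[ℝ] X) (Γ : Seminorm ℝ (ℝ × ℝ))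
    (f : ℝ → X → X) (γ ρ σ τ : ℝ) (η : X) (z : ℝ → X) : Prop :=
  MemE L Q Γ γ ρ σ τ z ∧ ∀ t ≤ τ, lpMap L Q f τ η z t = z t

/-- The solution `z_{τ,η}`: the fixed point of `H_{τ,η}` in `E_{σ,τ}`. Only its values on
`(-∞,τ]` are meaningful. -/
def lpSol (L : ℝ → ℝ → X →L[ℝ] X) (Q : ℝ → X →L[ℝ] X) (Γ : Seminorm ℝ (ℝ × ℝ))
    (f : ℝ → X → X) (γ ρ σ τ : ℝ) (η : X) : ℝ → X :=
  Classical.epsilon (IsLPFixedPoint L Q Γ f γ ρ σ τ η)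

/-- `Σ(τ,η) = (I - Q(τ)) z_{τ,η}(τ)`. -/
def sigmaMap (L : ℝ → ℝ → X →L[ℝ] X) (Q : ℝ → X →L[ℝ] X) (Γ : Seminorm ℝ (ℝ × ℝ))
    (f : ℝ → X → X) (γ ρ σ τ : ℝ) (η : X) : X :=
  complProj Q τ (lpSol L Q Γ f γ ρ σ τ η τ)

/-- The operator `A` is the (strong) integral over `I` of the operator-valued function `G`. -/
def HasStrongIntegral (G : ℝ → X →L[ℝ] X) (I : Set ℝ) (A : X →L[ℝ] X) : Prop :=
  ∀ w : X, IntegrableOn (fun s => G s w) I ∧ ∫ s in I, G s w = A w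

open Classical in
/-- The strong integral of an operator-valued function (zero if it does not exist). -/
def strongIntegral (G : ℝ → X →L[ℝ] X) (I : Set ℝ) : X →L[ℝ] X :=
  if h : ∃ A, HasStrongIntegral G I A then h.choose else 0

/-- The set of the numbers `e^{σ(t-τ)} ‖Z(t)w‖_t` with `t ≤ τ`, `‖w‖ ≤ 1`. -/
def weightedValues (L : ℝ → ℝ → X →L[ℝ] X) (Q : ℝ → X →L[ℝ] X) (Γ : Seminorm ℝ (ℝ × ℝ))
    (γ ρ σ τ : ℝ) (Z : ℝ → X →L[ℝ] X) : Set ℝ :=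
  {r | ∃ t : ℝ, ∃ w : X, t ≤ τ ∧ ‖w‖ ≤ 1 ∧
    r = Real.exp (σ * (t - τ)) * movingNorm L Q Γ γ ρ t (Z t w)}

/-- Membership in the weighted space `F_σ` of (strongly) continuous operator-valued functions on
`(-∞,τ]`. -/
def MemF (L : ℝ → ℝ → X →L[ℝ] X) (Q : ℝ → X →L[ℝ] X) (Γ : Seminorm ℝ (ℝ × ℝ))
    (γ ρ σ τ : ℝ) (Z : ℝ → X →L[ℝ] X) : Prop :=
  (∀ w : X, ContinuousOn (fun t => Z t w) (Iic τ)) ∧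
    BddAbove (weightedValues L Q Γ γ ρ σ τ Z)

/-- The norm of `F_σ`. -/
def normF (L : ℝ → ℝ → X →L[ℝ] X) (Q : ℝ → X →L[ℝ] X) (Γ : Seminorm ℝ (ℝ × ℝ))
    (γ ρ σ τ : ℝ) (Z : ℝ → X →L[ℝ] X) : ℝ :=
  sSup (weightedValues L Q Γ γ ρ σ τ Z)

/-- The integrand `L(t,s)Q(s)Df(s,z(s))Z(s)`, as a function of `s`. -/
def linUnstable (L : ℝ → ℝ → X →L[ℝ] X) (Q : ℝ → X →L[ℝ] X) (f : ℝ → X → X)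
    (z : ℝ → X) (Z : ℝ → X →L[ℝ] X) (t s : ℝ) : X →L[ℝ] X :=
  (unstableOp L Q t s) ∘L (fderiv ℝ (f s) (z s)) ∘L (Z s)

/-- The integrand `L(t,s)(I-Q(s))Df(s,z(s))Z(s)`, as a function of `s`. -/
def linStable (L : ℝ → ℝ → X →L[ℝ] X) (Q : ℝ → X →L[ℝ] X) (f : ℝ → X → X)
    (z : ℝ → X) (Z : ℝ → X →L[ℝ] X) (t s : ℝ) : X →L[ℝ] X :=
  (L t s) ∘L (complProj Q s) ∘L (fderiv ℝ (f s) (z s)) ∘L (Z s)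

/-- The linearization of the Lyapunov–Perron map along `z`, at times `t ≤ τ`:
`L(t,τ)Q(τ) - ∫_t^τ L(t,s)Q(s)Df(s,z(s))Z(s) ds + ∫_{-∞}^t L(t,s)(I-Q(s))Df(s,z(s))Z(s) ds`. -/
def linearizedMap (L : ℝ → ℝ → X →L[ℝ] X) (Q : ℝ → X →L[ℝ] X) (f : ℝ → X → X)
    (τ : ℝ) (z : ℝ → X) (Z : ℝ → X →L[ℝ] X) (t : ℝ) : X →L[ℝ] X :=
  unstableOp L Q t τ - strongIntegral (linUnstable L Q f z Z t) (Ioc t τ)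
    + strongIntegral (linStable L Q f z Z t) (Iic t)

end InertialManifold

end

/-! ### Algebra and strong continuity of the splitting -/

namespace InertialManifold

open Filter Topology

variable {X : Type*} [NormedAddCommGroup X] [NormedSpace ℝ X]
  {L : ℝ → ℝ → X →L[ℝ] X} {Q : ℝ → X →L[ℝ] X} {M γ ρ : ℝ}

/-! The equation for z reads z = L(·,τ)Q(τ)η + F(f(·,z)), where F (`lpForce`) integrates a forcing
against the splitting. The norms |·|_N and |·|_S are adapted to the evolution: moving a vector
backward in N or forward in S costs exactly an exponential factor, without the constant M. Hence a
forcing with components at most a e^{σ(τ-s)} and b e^{σ(τ-s)} has an image under F of size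
Γ(a/(σ-ρ), b/(γ-σ)) e^{σ(τ-t)}, and the Lipschitz bounds make the fixed-point map a contraction with
factor κ = Γ(L₁/(σ-ρ), L₂/(γ-σ)). The single estimate `isWeightBounded_lpMap_sub` yields existence,
uniqueness and Lipschitz dependence on η.

Limits of difference quotients show that u ↦ Df(s,z(s))u obeys the same two bounds and is measurable
along continuous curves (`isLipNonlinearity_fderiv`). The same theory therefore solves the
linearized equation, and uniqueness makes its solutions linear in the datum, which produces
operators Z(t).

It remains to see that Z is the derivative of z. Since Df need not be continuous in u, the Taylor
remainder R_h(s) is o(‖h‖) only for each fixed s; it is dominated by C‖h‖e^{σ(τ-s)}. The gap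
condition survives a small increase of σ to σ' (`exists_larger_exponent`), and with the weight
e^{σ'(s-τ)} the domination becomes integrable, so the weighted L¹ norm of R_h is o(‖h‖). The error w
= z_{η+h} - z_η - Zh solves w = F(Df·w) + F(R_h). As F maps weighted L¹ into the weighted sup space,
the contraction at exponent σ' gives w(t) = o(‖h‖). -/

lemma tendsto_clm_apply {α : Type*} {l : Filter α} {A : α → X →L[ℝ] X} {v : α → X} {v₀ y : X}
    {C : ℝ} (hA : ∀ᶠ a in l, ‖A a‖ ≤ C) (hv : Tendsto v l (𝓝 v₀))
    (hy : Tendsto (fun a => A a v₀) l (𝓝 y)) : Tendsto (fun a => A a (v a)) l (𝓝 y) := by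
  -- Local boundedness of the operators absorbs the variation of the vector; only strong convergence
  -- at the fixed v₀ is needed.
  have h : Tendsto (fun a => A a (v a - v₀)) l (𝓝 0) := by
    have h1 : Tendsto (fun a => C * ‖v a - v₀‖) l (𝓝 0) := by
      have : Tendsto (fun a => v a - v₀) l (𝓝 0) := by
        simpa using hv.sub_const v₀
      simpa using this.norm.const_mul C
    refine squeeze_zero_norm' ?_ h1
    filter_upwards [hA] with a ha
    exact (A a).le_of_opNorm_le ha _
  have := h.add hy
  simpa using this

lemma complProj_apply (t : ℝ) (x : X) : complProj Q t x = x - Q t x := rfl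

lemma proj_add_complProj (t : ℝ) (x : X) : Q t x + complProj Q t x = x := by
  simp [complProj_apply]

namespace HasExponentialSplitting

section algebra

variable (hQ : HasExponentialSplitting L Q M γ ρ)
include hQ

lemma proj_proj (t : ℝ) (x : X) : Q t (Q t x) = Q t x :=
  congrArg (fun A : X →L[ℝ] X => A x) (hQ.proj t)

lemma proj_complProj (t : ℝ) (x : X) : Q t (complProj Q t x) = 0 := by
  simp [complProj_apply, hQ.proj_proj]

lemma proj_evol {τ t : ℝ} (h : τ ≤ t) (x : X) : Q t (L t τ x) = L t τ (Q τ x) :=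
  congrArg (fun A : X →L[ℝ] X => A x) (hQ.commute τ t h)

lemma complProj_evol {τ t : ℝ} (h : τ ≤ t) (x : X) :
    complProj Q t (L t τ x) = L t τ (complProj Q τ x) := by
  simp [complProj_apply, hQ.proj_evol h]

lemma coe_unstableRestrict {τ t : ℝ} (h : τ ≤ t) (y : (Q τ).range) :
    (unstableRestrict L Q t τ y : X) = L t τ y := by
  obtain ⟨_, x, rfl⟩ := y
  change Q t (L t τ (Q τ x)) = L t τ (Q τ x)
  rw [hQ.proj_evol h, hQ.proj_proj]

lemma evol_injOn {τ t : ℝ} (h : τ ≤ t) {x y : X} (hx : Q τ x = x) (hy : Q τ y = y)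
    (hxy : L t τ x = L t τ y) : x = y := by
  have hinj : Function.Injective (unstableRestrict L Q t τ) := by
    obtain ⟨e, he⟩ := hQ.iso τ t h
    rw [← he]
    exact e.injective
  have := @hinj ⟨x, x, hx⟩ ⟨y, y, hy⟩ (by
    apply Subtype.ext
    rw [hQ.coe_unstableRestrict h, hQ.coe_unstableRestrict h]
    exact hxy)
  exact congrArg Subtype.val this

lemma M_nonneg : 0 ≤ M := zero_le_one.trans hQ.one_le

variable (hL : IsLinearEvolutionProcess L)
include hL

omit hQ in
lemma evol_self (t : ℝ) (x : X) : L t t x = x := by rw [hL.refl]; rfl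

omit hQ in
lemma evol_evol {r s t : ℝ} (h₁ : r ≤ s) (h₂ : s ≤ t) (x : X) : L t s (L s r x) = L t r x := by
  rw [hL.comp r s t h₁ h₂]; rfl

omit hQ in
lemma unstableOp_self (t : ℝ) : unstableOp L Q t t = Q t := by
  rw [unstableOp, if_pos le_rfl, hL.refl]; rfl

lemma proj_unstableOp {t s : ℝ} (h : t ≤ s) (x : X) :
    Q t (unstableOp L Q t s x) = unstableOp L Q t s x := by
  rcases h.eq_or_lt with rfl | h
  · rw [unstableOp_self hL, hQ.proj_proj]
  · rw [unstableOp, if_neg h.not_ge]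
    obtain ⟨y, hy⟩ := ((unstableRestrict L Q s t).inverse ((Q s).rangeRestrict x)).2
    change Q t ((unstableRestrict L Q s t).inverse ((Q s).rangeRestrict x) : X)
      = ((unstableRestrict L Q s t).inverse ((Q s).rangeRestrict x) : X)
    rw [← hy]
    exact hQ.proj_proj t y

lemma complProj_unstableOp {t s : ℝ} (h : t ≤ s) (x : X) :
    complProj Q t (unstableOp L Q t s x) = 0 := by
  rw [complProj_apply, hQ.proj_unstableOp hL h, sub_self]

lemma evol_unstableOp_self {t s : ℝ} (h : t ≤ s) (x : X) :
    L s t (unstableOp L Q t s x) = Q s x := by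
  rcases h.eq_or_lt with rfl | h
  · rw [unstableOp_self hL, evol_self hL]
  · rw [unstableOp, if_neg h.not_ge]
    change L s t ((unstableRestrict L Q s t).inverse ((Q s).rangeRestrict x) : X) = Q s x
    rw [← hQ.coe_unstableRestrict h.le]
    obtain ⟨e, he⟩ := hQ.iso t s h.le
    rw [← he, ContinuousLinearMap.inverse_equiv]
    exact congrArg Subtype.val (e.apply_symm_apply ((Q s).rangeRestrict x))

/-- Injectivity of L(s,t) on N(t) characterizes the backward operator; the algebraic laws below
follow by checking these two properties. -/
lemma eq_unstableOp {t s : ℝ} (h : t ≤ s) {x y : X} (hy : Q t y = y) (hxy : L s t y = Q s x) :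
    y = unstableOp L Q t s x :=
  hQ.evol_injOn h hy (hQ.proj_unstableOp hL h x) (by rw [hxy, hQ.evol_unstableOp_self hL h])

lemma unstableOp_evol_self {t s : ℝ} (h : t ≤ s) (y : X) :
    unstableOp L Q t s (L s t y) = Q t y :=
  (hQ.eq_unstableOp hL h (hQ.proj_proj t y) (hQ.proj_evol h y).symm).symm

lemma unstableOp_proj {t s : ℝ} (h : t ≤ s) (x : X) :
    unstableOp L Q t s (Q s x) = unstableOp L Q t s x :=
  hQ.eq_unstableOp hL h (hQ.proj_unstableOp hL h _)
    (by rw [hQ.evol_unstableOp_self hL h, hQ.proj_proj])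

lemma evol_unstableOp {r t s : ℝ} (h₁ : r ≤ t) (h₂ : t ≤ s) (x : X) :
    L t r (unstableOp L Q r s x) = unstableOp L Q t s x :=
  hQ.eq_unstableOp hL h₂
    (by rw [hQ.proj_evol h₁, hQ.proj_unstableOp hL (h₁.trans h₂)])
    (by rw [evol_evol hL h₁ h₂, hQ.evol_unstableOp_self hL (h₁.trans h₂)])

lemma unstableOp_unstableOp {r t s : ℝ} (h₁ : r ≤ t) (h₂ : t ≤ s) (x : X) :
    unstableOp L Q r t (unstableOp L Q t s x) = unstableOp L Q r s x :=
  hQ.eq_unstableOp hL (h₁.trans h₂) (hQ.proj_unstableOp hL h₁ _)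
    (by rw [← evol_evol hL h₁ h₂, hQ.evol_unstableOp_self hL h₁, hQ.proj_unstableOp hL h₂,
      hQ.evol_unstableOp_self hL h₂])

end algebra

section bounds

variable (hQ : HasExponentialSplitting L Q M γ ρ)
include hQ

lemma norm_unstableOp_le {t s : ℝ} (h : t ≤ s) :
    ‖unstableOp L Q t s‖ ≤ M * Real.exp (ρ * (s - t)) := by
  have h1 := hQ.unstable_bound s t h
  have h2 : Real.exp (ρ * (s - t)) * Real.exp (ρ * (t - s)) = 1 := by
    rw [← Real.exp_add, Real.exp_eq_one_iff]; ring
  have h3 := mul_le_mul_of_nonneg_left h1 (Real.exp_pos (ρ * (s - t))).le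
  rw [← mul_assoc, h2, one_mul] at h3
  linarith

lemma norm_stable_le {t s : ℝ} (h : s ≤ t) :
    ‖(L t s) ∘L (complProj Q s)‖ ≤ M * Real.exp (γ * (s - t)) := by
  have h1 := hQ.stable_bound s t h
  have h2 : Real.exp (γ * (s - t)) * Real.exp (γ * (t - s)) = 1 := by
    rw [← Real.exp_add, Real.exp_eq_one_iff]; ring
  have h3 := mul_le_mul_of_nonneg_left h1 (Real.exp_pos (γ * (s - t))).le
  rw [← mul_assoc, h2, one_mul] at h3
  linarith

lemma eventually_norm_unstableOp_le (t s₀ : ℝ) :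
    ∀ᶠ s in 𝓝[Ici t] s₀, ‖unstableOp L Q t s‖ ≤ M * Real.exp (ρ * (s₀ - t)) + 1 := by
  have h : Tendsto (fun s => M * Real.exp (ρ * (s - t))) (𝓝[Ici t] s₀)
      (𝓝 (M * Real.exp (ρ * (s₀ - t)))) :=
    (Continuous.tendsto (by fun_prop) s₀).mono_left nhdsWithin_le_nhds
  filter_upwards [h.eventually_le_const (lt_add_one _), self_mem_nhdsWithin] with s h1 h2
  exact (hQ.norm_unstableOp_le h2).trans h1

lemma eventually_norm_unstableOp_le' (t₀ s : ℝ) :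
    ∀ᶠ t in 𝓝[Iic s] t₀, ‖unstableOp L Q t s‖ ≤ M * Real.exp (ρ * (s - t₀)) + 1 := by
  have h : Tendsto (fun t => M * Real.exp (ρ * (s - t))) (𝓝[Iic s] t₀)
      (𝓝 (M * Real.exp (ρ * (s - t₀)))) :=
    (Continuous.tendsto (by fun_prop) t₀).mono_left nhdsWithin_le_nhds
  filter_upwards [h.eventually_le_const (lt_add_one _), self_mem_nhdsWithin] with t h1 h2
  exact (hQ.norm_unstableOp_le h2).trans h1

lemma eventually_norm_stable_le (t s₀ : ℝ) :
    ∀ᶠ s in 𝓝[Iic t] s₀,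
      ‖(L t s) ∘L (complProj Q s)‖ ≤ M * Real.exp (γ * (s₀ - t)) + 1 := by
  have h : Tendsto (fun s => M * Real.exp (γ * (s - t))) (𝓝[Iic t] s₀)
      (𝓝 (M * Real.exp (γ * (s₀ - t)))) :=
    (Continuous.tendsto (by fun_prop) s₀).mono_left nhdsWithin_le_nhds
  filter_upwards [h.eventually_le_const (lt_add_one _), self_mem_nhdsWithin] with s h1 h2
  exact (hQ.norm_stable_le h2).trans h1

variable (hL : IsLinearEvolutionProcess L)
include hL

lemma norm_proj_le (t : ℝ) : ‖Q t‖ ≤ M := by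
  simpa [unstableOp_self hL] using hQ.norm_unstableOp_le (le_refl t)

end bounds

section continuity

variable (hQ : HasExponentialSplitting L Q M γ ρ) (hL : IsLinearEvolutionProcess L)
include hL

lemma continuousOn_evol_left (s : ℝ) (x : X) : ContinuousOn (fun t => L t s x) (Ici s) :=
  (hL.strong_cont x).comp (f := fun t : ℝ => (t, s)) (by fun_prop) fun _ ht => ht

lemma continuousOn_evol_right (t : ℝ) (x : X) : ContinuousOn (fun s => L t s x) (Iic t) :=
  (hL.strong_cont x).comp (f := fun s : ℝ => (t, s)) (by fun_prop) fun _ ht => ht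

include hQ

lemma continuousOn_unstableOp_left (s : ℝ) (x : X) :
    ContinuousOn (fun t => unstableOp L Q t s x) (Iic s) := by
  intro t₀ ht₀
  -- Stepping back to time t₀ - 1 turns the backward orbit near t₀ into a forward orbit of a fixed
  -- vector.
  have h1 : ContinuousWithinAt (fun t => L t (t₀ - 1) (unstableOp L Q (t₀ - 1) s x)) (Iic s) t₀ :=
    ((continuousOn_evol_left hL (t₀ - 1) _).continuousAt
      (Ici_mem_nhds (by linarith))).continuousWithinAt
  refine h1.congr_of_eventuallyEq_of_mem ?_ ht₀
  filter_upwards [self_mem_nhdsWithin,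
    mem_nhdsWithin_of_mem_nhds (Ici_mem_nhds (by linarith : t₀ - 1 < t₀))] with t h2 h3
  exact (hQ.evol_unstableOp hL h3 h2 x).symm

/-- Continuity of the projections is a consequence of the splitting. For t ≤ t₀, Q(t)x is the
backward image of L(t₀,t)x; for t ≥ t₀, Q(t)x = L(t,t₀)Q(t₀)x - Q(t)(L(t,t₀)x - x). -/
lemma continuous_proj (x : X) : Continuous fun t => Q t x := by
  rw [continuous_iff_continuousAt]
  intro t₀
  rw [continuousAt_iff_continuous_left'_right']
  refine ⟨ContinuousWithinAt.mono ?_ Iio_subset_Iic_self,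
    ContinuousWithinAt.mono ?_ Ioi_subset_Ici_self⟩
  · have h1 : Tendsto (fun t => L t₀ t x) (𝓝[Iic t₀] t₀) (𝓝 x) := by
      simpa [ContinuousWithinAt, evol_self hL] using
        continuousOn_evol_right hL t₀ x t₀ self_mem_Iic
    have h2 : Tendsto (fun t => unstableOp L Q t t₀ x) (𝓝[Iic t₀] t₀) (𝓝 (Q t₀ x)) := by
      simpa [ContinuousWithinAt, unstableOp_self hL] using
        hQ.continuousOn_unstableOp_left hL t₀ x t₀ self_mem_Iic
    refine (tendsto_clm_apply (hQ.eventually_norm_unstableOp_le' t₀ t₀) h1 h2).congr' ?_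
    filter_upwards [self_mem_nhdsWithin] with t ht
    exact hQ.unstableOp_evol_self hL ht x
  · have h1 : Tendsto (fun t => L t t₀ x - x) (𝓝[Ici t₀] t₀) (𝓝 0) := by
      have := (continuousOn_evol_left hL t₀ x t₀ self_mem_Ici).sub_const x
      simpa [ContinuousWithinAt, evol_self hL] using this
    have h2 : Tendsto (fun t => Q t (L t t₀ x - x)) (𝓝[Ici t₀] t₀) (𝓝 0) :=
      tendsto_clm_apply (.of_forall fun t => hQ.norm_proj_le hL t) h1 (by simp)
    have h3 : Tendsto (fun t => L t t₀ (Q t₀ x)) (𝓝[Ici t₀] t₀) (𝓝 (Q t₀ x)) := by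
      simpa [ContinuousWithinAt, evol_self hL] using
        continuousOn_evol_left hL t₀ (Q t₀ x) t₀ self_mem_Ici
    have h4 := h3.sub h2
    rw [sub_zero] at h4
    refine h4.congr' ?_
    filter_upwards [self_mem_nhdsWithin] with t ht
    rw [map_sub, hQ.proj_evol ht, sub_sub_cancel]

lemma continuousOn_unstableOp_right (t : ℝ) (x : X) :
    ContinuousOn (fun s => unstableOp L Q t s x) (Ici t) := by
  intro s₀ hs₀
  -- Applying L(t,s)Q(s) to this vector gives the increment between s₀ and s of the function in
  -- question.
  have h1 : Tendsto (fun s => Q s x - L s t (unstableOp L Q t s₀ x)) (𝓝[Ici t] s₀) (𝓝 0) := by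
    have h2 := ((hQ.continuous_proj hL x).continuousWithinAt (s := Ici t) (x := s₀)).sub
      (continuousOn_evol_left hL t (unstableOp L Q t s₀ x) s₀ hs₀)
    rw [ContinuousWithinAt, Pi.sub_apply, hQ.evol_unstableOp_self hL (mem_Ici.1 hs₀),
      sub_self] at h2
    exact h2
  have h3 := tendsto_clm_apply (hQ.eventually_norm_unstableOp_le t s₀) h1
    (y := 0) (by simp [tendsto_const_nhds])
  have h4 := h3.add_const (unstableOp L Q t s₀ x)
  rw [zero_add] at h4
  refine Tendsto.congr' ?_ h4
  filter_upwards [self_mem_nhdsWithin] with s hs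
  rw [map_sub, hQ.unstableOp_proj hL hs, hQ.unstableOp_evol_self hL hs,
    hQ.proj_unstableOp hL hs₀, sub_add_cancel]

lemma continuousOn_stable_right (t : ℝ) (x : X) :
    ContinuousOn (fun s => L t s (complProj Q s x)) (Iic t) :=
  ((complProj Q t).continuous.comp_continuousOn (continuousOn_evol_right hL t x)).congr
    fun _ hs => (hQ.complProj_evol hs x).symm

/-- Clamping the time at t gives a jointly continuous map on all of ℝ × X, which may be composed
with a merely measurable forcing. -/
lemma continuous_unstableOp_max (t : ℝ) :
    Continuous fun p : ℝ × X => unstableOp L Q t (max p.1 t) p.2 := by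
  rw [continuous_iff_continuousAt]
  intro p
  have h : Tendsto (fun q : ℝ × X => max q.1 t) (𝓝 p) (𝓝[Ici t] (max p.1 t)) :=
    tendsto_nhdsWithin_iff.2 ⟨Continuous.tendsto (by fun_prop) p,
      .of_forall fun q => mem_Ici.2 (le_max_right _ _)⟩
  exact tendsto_clm_apply (A := fun q : ℝ × X => unstableOp L Q t (max q.1 t))
    (h.eventually (hQ.eventually_norm_unstableOp_le t _)) continuous_snd.continuousAt
    ((hQ.continuousOn_unstableOp_right hL t p.2 _ (mem_Ici.2 (le_max_right _ _))).tendsto.comp h)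

lemma continuous_stable_min (t : ℝ) :
    Continuous fun p : ℝ × X => L t (min p.1 t) (complProj Q (min p.1 t) p.2) := by
  rw [continuous_iff_continuousAt]
  intro p
  have h : Tendsto (fun q : ℝ × X => min q.1 t) (𝓝 p) (𝓝[Iic t] (min p.1 t)) :=
    tendsto_nhdsWithin_iff.2 ⟨Continuous.tendsto (by fun_prop) p,
      .of_forall fun q => mem_Iic.2 (min_le_right _ _)⟩
  exact tendsto_clm_apply
    (A := fun q : ℝ × X => (L t (min q.1 t)) ∘L (complProj Q (min q.1 t)))
    (h.eventually (hQ.eventually_norm_stable_le t _)) continuous_snd.continuousAt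
    ((hQ.continuousOn_stable_right hL t p.2 _ (mem_Iic.2 (min_le_right _ _))).tendsto.comp h)

lemma aestronglyMeasurable_unstableOp {t : ℝ} {I : Set ℝ} (hI : MeasurableSet I)
    (hIt : I ⊆ Ici t) {g : ℝ → X} (hg : AEStronglyMeasurable g (volume.restrict I)) :
    AEStronglyMeasurable (fun s => unstableOp L Q t s (g s)) (volume.restrict I) := by
  have h1 := (hQ.continuous_unstableOp_max hL t).comp_aestronglyMeasurable
    (aestronglyMeasurable_id.prodMk hg)
  refine h1.congr ?_
  filter_upwards [ae_restrict_mem hI] with s hs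
  simp [max_eq_left (mem_Ici.1 (hIt hs))]

lemma aestronglyMeasurable_stable {t : ℝ} {I : Set ℝ} (hI : MeasurableSet I)
    (hIt : I ⊆ Iic t) {g : ℝ → X} (hg : AEStronglyMeasurable g (volume.restrict I)) :
    AEStronglyMeasurable (fun s => L t s (complProj Q s (g s))) (volume.restrict I) := by
  have h1 := (hQ.continuous_stable_min hL t).comp_aestronglyMeasurable
    (aestronglyMeasurable_id.prodMk hg)
  refine h1.congr ?_
  filter_upwards [ae_restrict_mem hI] with s hs
  simp [min_eq_left (mem_Iic.1 (hIt hs))]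

end continuity

end HasExponentialSplitting

end InertialManifold

/-! ### The fibre norms and the moving norm -/

namespace InertialManifold

open Filter Topology

variable {X : Type*} [NormedAddCommGroup X] [NormedSpace ℝ X]
  {L : ℝ → ℝ → X →L[ℝ] X} {Q : ℝ → X →L[ℝ] X} {M γ ρ : ℝ} {Γ : Seminorm ℝ (ℝ × ℝ)}

namespace IsAdmissible

variable (hΓ : IsAdmissible Γ)
include hΓ

lemma mono {a a' b b' : ℝ} (ha : 0 ≤ a) (haa' : a ≤ a') (hb : 0 ≤ b) (hbb' : b ≤ b') :
    Γ (a, b) ≤ Γ (a', b') :=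
  (hΓ.mono_left b hb ha (ha.trans haa') haa').trans
    (hΓ.mono_right a' (ha.trans haa') hb (hb.trans hbb') hbb')

omit hΓ in
lemma mul_eq {c a b : ℝ} (hc : 0 ≤ c) : Γ (c * a, c * b) = c * Γ (a, b) := by
  have h := map_smul_eq_mul Γ c (a, b)
  rwa [Real.norm_of_nonneg hc] at h

lemma pos_left : 0 < Γ (1, 0) :=
  (apply_nonneg Γ _).lt_of_ne fun h => by simpa using hΓ.definite _ h.symm

lemma pos_right : 0 < Γ (0, 1) :=
  (apply_nonneg Γ _).lt_of_ne fun h => by simpa using hΓ.definite _ h.symm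

lemma add_le {a b : ℝ} (ha : 0 ≤ a) (hb : 0 ≤ b) :
    a + b ≤ ((Γ (1, 0))⁻¹ + (Γ (0, 1))⁻¹) * Γ (a, b) := by
  have h1 : a * Γ (1, 0) ≤ Γ (a, b) := by
    have := hΓ.mono ha le_rfl le_rfl hb
    rwa [show ((a, 0) : ℝ × ℝ) = (a * 1, a * 0) by simp, mul_eq ha] at this
  have h2 : b * Γ (0, 1) ≤ Γ (a, b) := by
    have := hΓ.mono le_rfl ha hb le_rfl
    rwa [show ((0, b) : ℝ × ℝ) = (b * 0, b * 1) by simp, mul_eq hb] at this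
  rw [add_mul, inv_mul_eq_div, inv_mul_eq_div]
  exact add_le_add ((le_div_iff₀ hΓ.pos_left).2 h1) ((le_div_iff₀ hΓ.pos_right).2 h2)

end IsAdmissible

section homogeneity

lemma normN_smul (t c : ℝ) (x : X) : normN L Q ρ t (c • x) = |c| * normN L Q ρ t x := by
  rw [normN, normN, Real.mul_iSup_of_nonneg (abs_nonneg c)]
  congr with r
  rw [map_smul, norm_smul, Real.norm_eq_abs]
  ring

lemma normS_smul (t c : ℝ) (x : X) : normS L γ t (c • x) = |c| * normS L γ t x := by
  rw [normS, normS, Real.mul_iSup_of_nonneg (abs_nonneg c)]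
  congr with r
  rw [map_smul, norm_smul, Real.norm_eq_abs]
  ring

lemma normN_nonneg (t : ℝ) (x : X) : 0 ≤ normN L Q ρ t x :=
  Real.iSup_nonneg fun _ => by positivity

lemma normS_nonneg (t : ℝ) (x : X) : 0 ≤ normS L γ t x :=
  Real.iSup_nonneg fun _ => by positivity

lemma movingNorm_nonneg (t : ℝ) (x : X) : 0 ≤ movingNorm L Q Γ γ ρ t x := apply_nonneg Γ _

lemma movingNorm_smul (t c : ℝ) (x : X) :
    movingNorm L Q Γ γ ρ t (c • x) = |c| * movingNorm L Q Γ γ ρ t x := by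
  rw [movingNorm, map_smul, map_smul, normN_smul, normS_smul,
    IsAdmissible.mul_eq (abs_nonneg c), movingNorm]

lemma movingNorm_zero (t : ℝ) : movingNorm L Q Γ γ ρ t (0 : X) = 0 := by
  simpa using movingNorm_smul (L := L) (Q := Q) (Γ := Γ) (γ := γ) (ρ := ρ) t 0 (0 : X)

end homogeneity

section bounds

variable (hQ : HasExponentialSplitting L Q M γ ρ) (hL : IsLinearEvolutionProcess L)

lemma normN_proj_le {t a : ℝ} {x : X}
    (h : ∀ r ≤ t, Real.exp (ρ * (r - t)) * ‖unstableOp L Q r t (Q t x)‖ ≤ a) :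
    normN L Q ρ t (Q t x) ≤ a :=
  ciSup_le fun r => h r r.2

lemma normS_complProj_le {t a : ℝ} {x : X}
    (h : ∀ r, t ≤ r → Real.exp (γ * (r - t)) * ‖L r t (complProj Q t x)‖ ≤ a) :
    normS L γ t (complProj Q t x) ≤ a :=
  ciSup_le fun r => h r r.2

include hQ

lemma exp_mul_unstableOp_le {r t : ℝ} (h : r ≤ t) (x : X) :
    Real.exp (ρ * (r - t)) * ‖unstableOp L Q r t x‖ ≤ M * ‖x‖ :=
  calc Real.exp (ρ * (r - t)) * ‖unstableOp L Q r t x‖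
      ≤ Real.exp (ρ * (r - t)) * (‖unstableOp L Q r t‖ * ‖x‖) := by
        gcongr; exact ContinuousLinearMap.le_opNorm _ _
    _ ≤ M * ‖x‖ := by
        rw [← mul_assoc]; gcongr; exact hQ.unstable_bound t r h

lemma exp_mul_stable_le {r t : ℝ} (h : t ≤ r) (x : X) :
    Real.exp (γ * (r - t)) * ‖L r t (complProj Q t x)‖ ≤ M * ‖x‖ :=
  calc Real.exp (γ * (r - t)) * ‖L r t (complProj Q t x)‖
      ≤ Real.exp (γ * (r - t)) * (‖L r t ∘L complProj Q t‖ * ‖x‖) := by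
        gcongr; exact (L r t ∘L complProj Q t).le_opNorm x
    _ ≤ M * ‖x‖ := by
        rw [← mul_assoc]; gcongr; exact hQ.stable_bound t r h

/-- The exponential bound makes the family bounded by M‖x‖; without boundedness the real supremum
would take its default value 0. -/
lemma le_normN {r t : ℝ} (h : r ≤ t) (x : X) :
    Real.exp (ρ * (r - t)) * ‖unstableOp L Q r t x‖ ≤ normN L Q ρ t x :=
  le_ciSup (f := fun r : Iic t => Real.exp (ρ * (r - t)) * ‖unstableOp L Q r t x‖)
    ⟨M * ‖x‖, by rintro _ ⟨r, rfl⟩; exact exp_mul_unstableOp_le hQ r.2 x⟩ ⟨r, h⟩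

lemma le_normS {r t : ℝ} (h : t ≤ r) (x : X) :
    Real.exp (γ * (r - t)) * ‖L r t (complProj Q t x)‖ ≤ normS L γ t (complProj Q t x) :=
  le_ciSup (f := fun r : Ici t => Real.exp (γ * (r - t)) * ‖L r t (complProj Q t x)‖)
    ⟨M * ‖x‖, by rintro _ ⟨r, rfl⟩; exact exp_mul_stable_le hQ r.2 x⟩ ⟨r, h⟩

lemma normS_complProj_le_norm (t : ℝ) (x : X) :
    normS L γ t (complProj Q t x) ≤ M * ‖x‖ :=
  normS_complProj_le fun _ hr => exp_mul_stable_le hQ hr x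

lemma normS_complProj_add_le (t : ℝ) (x y : X) :
    normS L γ t (complProj Q t (x + y)) ≤
      normS L γ t (complProj Q t x) + normS L γ t (complProj Q t y) := by
  refine normS_complProj_le fun r hr => ?_
  rw [map_add, map_add]
  refine le_trans ?_ (add_le_add (le_normS hQ hr x) (le_normS hQ hr y))
  rw [← mul_add]
  gcongr
  exact norm_add_le _ _

lemma normN_proj_add_le (t : ℝ) (x y : X) :
    normN L Q ρ t (Q t (x + y)) ≤ normN L Q ρ t (Q t x) + normN L Q ρ t (Q t y) := by
  refine normN_proj_le fun r hr => ?_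
  rw [map_add, map_add]
  refine le_trans ?_ (add_le_add (le_normN hQ hr _) (le_normN hQ hr _))
  rw [← mul_add]
  gcongr
  exact norm_add_le _ _

include hL

lemma normN_proj_le_norm (t : ℝ) (x : X) : normN L Q ρ t (Q t x) ≤ M * ‖x‖ := by
  refine normN_proj_le fun r hr => ?_
  rw [hQ.unstableOp_proj hL hr]
  exact exp_mul_unstableOp_le hQ hr x

lemma norm_proj_le_normN (t : ℝ) (x : X) : ‖Q t x‖ ≤ normN L Q ρ t (Q t x) := by
  simpa [HasExponentialSplitting.unstableOp_self hL, hQ.proj_proj]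
    using le_normN hQ (le_refl t) (Q t x)

lemma norm_complProj_le_normS (t : ℝ) (x : X) :
    ‖complProj Q t x‖ ≤ normS L γ t (complProj Q t x) := by
  simpa [HasExponentialSplitting.evol_self hL] using le_normS hQ (le_refl t) x

end bounds

section movingNorm

variable (hQ : HasExponentialSplitting L Q M γ ρ) (hL : IsLinearEvolutionProcess L)
  (hΓ : IsAdmissible Γ)
include hΓ

lemma movingNorm_le {t a b : ℝ} {x : X} (ha : normN L Q ρ t (Q t x) ≤ a)
    (hb : normS L γ t (complProj Q t x) ≤ b) : movingNorm L Q Γ γ ρ t x ≤ Γ (a, b) :=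
  hΓ.mono (normN_nonneg _ _) ha (normS_nonneg _ _) hb

include hQ

lemma movingNorm_add_le (t : ℝ) (x y : X) :
    movingNorm L Q Γ γ ρ t (x + y)
      ≤ movingNorm L Q Γ γ ρ t x + movingNorm L Q Γ γ ρ t y :=
  (movingNorm_le hΓ (normN_proj_add_le hQ t x y) (normS_complProj_add_le hQ t x y)).trans
    (map_add_le_add Γ (normN L Q ρ t (Q t x), normS L γ t (complProj Q t x))
      (normN L Q ρ t (Q t y), normS L γ t (complProj Q t y)))

include hL

lemma movingNorm_le_norm (t : ℝ) (x : X) :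
    movingNorm L Q Γ γ ρ t x ≤ Γ (M, M) * ‖x‖ := by
  have h := movingNorm_le hΓ (normN_proj_le_norm hQ hL t x) (normS_complProj_le_norm hQ t x)
  rwa [mul_comm M, IsAdmissible.mul_eq (norm_nonneg x), mul_comm] at h

/-- Together with `movingNorm_le_norm` this makes ‖·‖_t equivalent to ‖·‖ with constants independent
of t. -/
lemma norm_le_movingNorm (t : ℝ) (x : X) :
    ‖x‖ ≤ ((Γ (1, 0))⁻¹ + (Γ (0, 1))⁻¹) * movingNorm L Q Γ γ ρ t x :=
  calc ‖x‖ = ‖Q t x + complProj Q t x‖ := by rw [proj_add_complProj]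
    _ ≤ ‖Q t x‖ + ‖complProj Q t x‖ := norm_add_le _ _
    _ ≤ normN L Q ρ t (Q t x) + normS L γ t (complProj Q t x) :=
        add_le_add (norm_proj_le_normN hQ hL t x) (norm_complProj_le_normS hQ hL t x)
    _ ≤ _ := hΓ.add_le (normN_nonneg _ _) (normS_nonneg _ _)

end movingNorm

end InertialManifold

/-! ### Forcings and the integral operator -/

namespace InertialManifold

open Filter Topology

variable {X : Type*} [NormedAddCommGroup X] [NormedSpace ℝ X]
  {L : ℝ → ℝ → X →L[ℝ] X} {Q : ℝ → X →L[ℝ] X} {M γ ρ : ℝ} {Γ : Seminorm ℝ (ℝ × ℝ)}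
  {σ τ a b a' b' : ℝ} {g g' : ℝ → X}

lemma integrableOn_weight_Ioi (h : ρ < σ) (a c t : ℝ) :
    IntegrableOn (fun s => a * (c * Real.exp ((ρ - σ) * s))) (Ioi t) :=
  ((integrableOn_exp_mul_Ioi (sub_neg.2 h) t).const_mul c).const_mul a

lemma integrableOn_weight_Iic (h : σ < γ) (b c t : ℝ) :
    IntegrableOn (fun s => b * (c * Real.exp ((γ - σ) * s))) (Iic t) :=
  ((integrableOn_exp_mul_Iic (sub_pos.2 h) t).const_mul c).const_mul b

/-- The integral part of the Lyapunov–Perron map, for a given forcing `g`. -/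
noncomputable def lpForce (L : ℝ → ℝ → X →L[ℝ] X) (Q : ℝ → X →L[ℝ] X) (τ : ℝ) (g : ℝ → X) (t : ℝ) : X :=
  -(∫ s in Ioc t τ, unstableOp L Q t s (g s)) + ∫ s in Iic t, L t s (complProj Q s (g s))

/-- Measurable functions `g` on `(-∞,τ]` with `|Q(s)g(s)|_{N(s)} ≤ a e^{σ(τ-s)}` and
`|(I-Q(s))g(s)|_{S(s)} ≤ b e^{σ(τ-s)}`. -/
structure IsForcing (L : ℝ → ℝ → X →L[ℝ] X) (Q : ℝ → X →L[ℝ] X) (γ ρ σ τ a b : ℝ)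
    (g : ℝ → X) : Prop where
  meas : AEStronglyMeasurable g (volume.restrict (Iic τ))
  normN_le : ∀ s ≤ τ, normN L Q ρ s (Q s (g s)) ≤ a * Real.exp (σ * (τ - s))
  normS_le : ∀ s ≤ τ, normS L γ s (complProj Q s (g s)) ≤ b * Real.exp (σ * (τ - s))

/-- Separates the integration variable s from t, so that the weights integrate explicitly. -/
lemma exp_weight (c σ τ t s : ℝ) :
    Real.exp (c * (s - t)) * Real.exp (σ * (τ - s))
      = Real.exp (σ * τ - c * t) * Real.exp ((c - σ) * s) := by
  rw [← Real.exp_add, ← Real.exp_add]; ring_nf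

lemma exp_weight_self (c σ τ t : ℝ) :
    Real.exp (σ * τ - c * t) * Real.exp ((c - σ) * t) = Real.exp (σ * (τ - t)) := by
  rw [← Real.exp_add]; ring_nf

namespace IsForcing

section basic

lemma nonneg_left (hg : IsForcing L Q γ ρ σ τ a b g) : 0 ≤ a := by
  simpa using (normN_nonneg _ _).trans (hg.normN_le τ le_rfl)

lemma nonneg_right (hg : IsForcing L Q γ ρ σ τ a b g) : 0 ≤ b := by
  simpa using (normS_nonneg _ _).trans (hg.normS_le τ le_rfl)

lemma mono_exponent {σ' : ℝ} (hg : IsForcing L Q γ ρ σ τ a b g) (h : σ ≤ σ') :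
    IsForcing L Q γ ρ σ' τ a b g where
  meas := hg.meas
  normN_le s hs := (hg.normN_le s hs).trans <| by
    have := hg.nonneg_left
    have := sub_nonneg.2 hs
    gcongr
  normS_le s hs := (hg.normS_le s hs).trans <| by
    have := hg.nonneg_right
    have := sub_nonneg.2 hs
    gcongr

lemma add (hQ : HasExponentialSplitting L Q M γ ρ) (hg : IsForcing L Q γ ρ σ τ a b g)
    (hg' : IsForcing L Q γ ρ σ τ a' b' g') :
    IsForcing L Q γ ρ σ τ (a + a') (b + b') (fun s => g s + g' s) where
  meas := hg.meas.add hg'.meas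
  normN_le s hs := by
    rw [add_mul]
    exact (normN_proj_add_le hQ _ _ _).trans (add_le_add (hg.normN_le s hs) (hg'.normN_le s hs))
  normS_le s hs := by
    rw [add_mul]
    exact (normS_complProj_add_le hQ _ _ _).trans
      (add_le_add (hg.normS_le s hs) (hg'.normS_le s hs))

lemma neg (hg : IsForcing L Q γ ρ σ τ a b g) :
    IsForcing L Q γ ρ σ τ a b (fun s => -g s) where
  meas := hg.meas.neg
  normN_le s hs := by
    have := normN_smul (L := L) (Q := Q) (ρ := ρ) s (-1) (Q s (g s))
    rw [neg_one_smul, abs_neg, abs_one, one_mul] at this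
    rw [map_neg, this]
    exact hg.normN_le s hs
  normS_le s hs := by
    have := normS_smul (L := L) (γ := γ) s (-1) (complProj Q s (g s))
    rw [neg_one_smul, abs_neg, abs_one, one_mul] at this
    rw [map_neg, this]
    exact hg.normS_le s hs

lemma sub (hQ : HasExponentialSplitting L Q M γ ρ) (hg : IsForcing L Q γ ρ σ τ a b g)
    (hg' : IsForcing L Q γ ρ σ τ a' b' g') :
    IsForcing L Q γ ρ σ τ (a + a') (b + b') (fun s => g s - g' s) := by
  simpa only [sub_eq_add_neg] using hg.add hQ hg'.neg

end basic

section integrability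

variable (hQ : HasExponentialSplitting L Q M γ ρ) (hL : IsLinearEvolutionProcess L)
  (hσ : σ ∈ Ioo ρ γ) (hg : IsForcing L Q γ ρ σ τ a b g)

include hQ hg

lemma norm_stable_le {t s : ℝ} (hts : s ≤ t) (hs : s ≤ τ) :
    ‖L t s (complProj Q s (g s))‖
      ≤ b * (Real.exp (σ * τ - γ * t) * Real.exp ((γ - σ) * s)) := by
  rw [← exp_weight]
  have h1 := (le_normS hQ hts (g s)).trans (hg.normS_le s hs)
  have h2 := mul_le_mul_of_nonneg_left h1 (Real.exp_pos (γ * (s - t))).le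
  rw [← mul_assoc, ← Real.exp_add, show γ * (s - t) + γ * (t - s) = 0 by ring, Real.exp_zero,
    one_mul] at h2
  linarith

include hL

lemma norm_unstable_le {t s : ℝ} (hts : t ≤ s) (hs : s ≤ τ) :
    ‖unstableOp L Q t s (g s)‖
      ≤ a * (Real.exp (σ * τ - ρ * t) * Real.exp ((ρ - σ) * s)) := by
  rw [← exp_weight, ← hQ.unstableOp_proj hL hts]
  have h1 := (le_normN hQ hts (Q s (g s))).trans (hg.normN_le s hs)
  have h2 := mul_le_mul_of_nonneg_left h1 (Real.exp_pos (ρ * (s - t))).le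
  rw [← mul_assoc, ← Real.exp_add, show ρ * (s - t) + ρ * (t - s) = 0 by ring, Real.exp_zero,
    one_mul] at h2
  linarith

include hσ

lemma integrableOn_unstable (t : ℝ) :
    IntegrableOn (fun s => unstableOp L Q t s (g s)) (Ioc t τ) := by
  have h := (integrableOn_weight_Ioi hσ.1 a (Real.exp (σ * τ - ρ * t)) t).mono_set
    (Ioc_subset_Ioi_self : Ioc t τ ⊆ Ioi t)
  refine Integrable.mono' h (hQ.aestronglyMeasurable_unstableOp hL measurableSet_Ioc
    (fun s hs => hs.1.le) (hg.meas.mono_set Ioc_subset_Iic_self)) ?_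
  filter_upwards [ae_restrict_mem measurableSet_Ioc] with s hs
  exact hg.norm_unstable_le hQ hL hs.1.le hs.2

lemma integrableOn_stable {t : ℝ} (ht : t ≤ τ) :
    IntegrableOn (fun s => L t s (complProj Q s (g s))) (Iic t) := by
  have h := integrableOn_weight_Iic hσ.2 b (Real.exp (σ * τ - γ * t)) t
  refine Integrable.mono' h (hQ.aestronglyMeasurable_stable hL measurableSet_Iic
    subset_rfl (hg.meas.mono_set (Iic_subset_Iic.2 ht))) ?_
  filter_upwards [ae_restrict_mem measurableSet_Iic] with s hs
  exact hg.norm_stable_le hQ hs (le_trans hs ht)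

lemma lpForce_add (hg' : IsForcing L Q γ ρ σ τ a' b' g') {t : ℝ} (ht : t ≤ τ) :
    lpForce L Q τ (fun s => g s + g' s) t = lpForce L Q τ g t + lpForce L Q τ g' t := by
  simp only [lpForce, map_add]
  rw [integral_add (hg.integrableOn_unstable hQ hL hσ t) (hg'.integrableOn_unstable hQ hL hσ t),
    integral_add (hg.integrableOn_stable hQ hL hσ ht) (hg'.integrableOn_stable hQ hL hσ ht)]
  abel

lemma lpForce_sub (hg' : IsForcing L Q γ ρ σ τ a' b' g') {t : ℝ} (ht : t ≤ τ) :
    lpForce L Q τ (fun s => g s - g' s) t = lpForce L Q τ g t - lpForce L Q τ g' t := by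
  simp only [lpForce, map_sub]
  rw [integral_sub (hg.integrableOn_unstable hQ hL hσ t) (hg'.integrableOn_unstable hQ hL hσ t),
    integral_sub (hg.integrableOn_stable hQ hL hσ ht) (hg'.integrableOn_stable hQ hL hσ ht)]
  abel

end integrability

section components

variable [CompleteSpace X]
  (hQ : HasExponentialSplitting L Q M γ ρ) (hL : IsLinearEvolutionProcess L)
  (hσ : σ ∈ Ioo ρ γ) (hg : IsForcing L Q γ ρ σ τ a b g)

include hQ hL hg hσ

/-- The unstable integrand lies in N(t) and the stable one in the kernel of Q(t), so Q(t) separates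
the two integrals. -/
lemma proj_lpForce {t : ℝ} (ht : t ≤ τ) :
    Q t (lpForce L Q τ g t) = -∫ s in Ioc t τ, unstableOp L Q t s (g s) := by
  rw [lpForce, map_add, map_neg,
    ← (Q t).integral_comp_comm (hg.integrableOn_unstable hQ hL hσ t),
    ← (Q t).integral_comp_comm (hg.integrableOn_stable hQ hL hσ ht)]
  have h1 : ∫ s in Ioc t τ, Q t (unstableOp L Q t s (g s))
      = ∫ s in Ioc t τ, unstableOp L Q t s (g s) :=
    setIntegral_congr_fun measurableSet_Ioc fun s hs => hQ.proj_unstableOp hL hs.1.le _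
  have h2 : ∫ s in Iic t, Q t (L t s (complProj Q s (g s))) = 0 := by
    rw [setIntegral_congr_fun measurableSet_Iic (g := fun _ => (0 : X)), integral_zero]
    intro s hs
    change Q t (L t s (complProj Q s (g s))) = 0
    rw [hQ.proj_evol hs, hQ.proj_complProj, map_zero]
  rw [h1, h2, add_zero]

lemma complProj_lpForce {t : ℝ} (ht : t ≤ τ) :
    complProj Q t (lpForce L Q τ g t) = ∫ s in Iic t, L t s (complProj Q s (g s)) := by
  rw [complProj_apply, hg.proj_lpForce hQ hL hσ ht, lpForce]
  abel

/-- For r ≤ t ≤ s the cocycle law and the supremum in |·|_{N(s)} give e^{ρ(r-t)}‖L(r,s)Q(s)g‖ ≤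
e^{ρ(s-t)}|Q(s)g|_{N(s)}. No factor M appears, which is why the gap condition is free of M. -/
lemma normN_lpForce_le_integral {φ : ℝ → ℝ} {t : ℝ} (ht : t ≤ τ)
    (hφ : IntegrableOn φ (Ioc t τ))
    (h : ∀ s ∈ Ioc t τ, Real.exp (ρ * (s - t)) * normN L Q ρ s (Q s (g s)) ≤ φ s) :
    normN L Q ρ t (Q t (lpForce L Q τ g t)) ≤ ∫ s in Ioc t τ, φ s := by
  refine normN_proj_le fun r hr => ?_
  rw [hg.proj_lpForce hQ hL hσ ht, map_neg, norm_neg,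
    ← (unstableOp L Q r t).integral_comp_comm (hg.integrableOn_unstable hQ hL hσ t)]
  have h1 : ‖∫ s in Ioc t τ, unstableOp L Q r t (unstableOp L Q t s (g s))‖
      ≤ ∫ s in Ioc t τ, Real.exp (ρ * (t - r)) * φ s := by
    refine norm_integral_le_of_norm_le (hφ.const_mul _) ?_
    filter_upwards [ae_restrict_mem measurableSet_Ioc] with s hs
    rw [hQ.unstableOp_unstableOp hL hr hs.1.le]
    have h2 := le_normN hQ (hr.trans hs.1.le) (Q s (g s))
    rw [hQ.unstableOp_proj hL (hr.trans hs.1.le)] at h2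
    have h3 := (mul_le_mul_of_nonneg_left h2 (Real.exp_pos (ρ * (s - t))).le).trans (h s hs)
    have h4 := mul_le_mul_of_nonneg_left h3 (Real.exp_pos (ρ * (t - r))).le
    rwa [← mul_assoc, ← mul_assoc, ← Real.exp_add, ← Real.exp_add,
      show ρ * (t - r) + ρ * (s - t) + ρ * (r - s) = 0 by ring, Real.exp_zero, one_mul] at h4
  rw [integral_const_mul] at h1
  have h5 := mul_le_mul_of_nonneg_left h1 (Real.exp_pos (ρ * (r - t))).le
  rwa [← mul_assoc, ← Real.exp_add, show ρ * (r - t) + ρ * (t - r) = 0 by ring, Real.exp_zero,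
    one_mul] at h5

lemma normS_lpForce_le_integral {φ : ℝ → ℝ} {t : ℝ} (ht : t ≤ τ)
    (hφ : IntegrableOn φ (Iic t))
    (h : ∀ s ≤ t, Real.exp (γ * (s - t)) * normS L γ s (complProj Q s (g s)) ≤ φ s) :
    normS L γ t (complProj Q t (lpForce L Q τ g t)) ≤ ∫ s in Iic t, φ s := by
  refine normS_complProj_le fun r hr => ?_
  rw [hg.complProj_lpForce hQ hL hσ ht,
    ← (L r t).integral_comp_comm (hg.integrableOn_stable hQ hL hσ ht)]
  have h1 : ‖∫ s in Iic t, L r t (L t s (complProj Q s (g s)))‖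
      ≤ ∫ s in Iic t, Real.exp (γ * (t - r)) * φ s := by
    refine norm_integral_le_of_norm_le (hφ.const_mul _) ?_
    filter_upwards [ae_restrict_mem measurableSet_Iic] with s hs
    rw [HasExponentialSplitting.evol_evol hL hs hr]
    have h2 := le_normS hQ (le_trans hs hr) (g s)
    have h3 := (mul_le_mul_of_nonneg_left h2 (Real.exp_pos (γ * (s - t))).le).trans (h s hs)
    have h4 := mul_le_mul_of_nonneg_left h3 (Real.exp_pos (γ * (t - r))).le
    rwa [← mul_assoc, ← mul_assoc, ← Real.exp_add, ← Real.exp_add,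
      show γ * (t - r) + γ * (s - t) + γ * (r - s) = 0 by ring, Real.exp_zero, one_mul] at h4
  rw [integral_const_mul] at h1
  have h5 := mul_le_mul_of_nonneg_left h1 (Real.exp_pos (γ * (r - t))).le
  rwa [← mul_assoc, ← Real.exp_add, show γ * (r - t) + γ * (t - r) = 0 by ring, Real.exp_zero,
    one_mul] at h5

lemma normN_lpForce_le {t : ℝ} (ht : t ≤ τ) :
    normN L Q ρ t (Q t (lpForce L Q τ g t)) ≤ a / (σ - ρ) * Real.exp (σ * (τ - t)) := by
  have hi := integrableOn_weight_Ioi hσ.1 a (Real.exp (σ * τ - ρ * t)) t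
  refine (hg.normN_lpForce_le_integral hQ hL hσ ht (hi.mono_set Ioc_subset_Ioi_self)
    fun s hs => ?_).trans ?_
  · have := mul_le_mul_of_nonneg_left (hg.normN_le s hs.2) (Real.exp_pos (ρ * (s - t))).le
    rw [← exp_weight]
    linarith
  -- Enlarging (t,τ] to (t,∞) gives the exact value 1/(σ-ρ) and removes the dependence on the length
  -- of the interval.
  · refine (setIntegral_mono_set hi (.of_forall fun s => ?_)
      Ioc_subset_Ioi_self.eventuallyLE).trans_eq ?_
    · have := hg.nonneg_left
      positivity
    · rw [integral_const_mul, integral_const_mul, integral_exp_mul_Ioi (sub_neg.2 hσ.1),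
        ← exp_weight_self ρ]
      have : σ - ρ ≠ 0 := (sub_pos.2 hσ.1).ne'
      have : ρ - σ ≠ 0 := (sub_neg.2 hσ.1).ne
      field_simp
      ring

lemma normS_lpForce_le {t : ℝ} (ht : t ≤ τ) :
    normS L γ t (complProj Q t (lpForce L Q τ g t))
      ≤ b / (γ - σ) * Real.exp (σ * (τ - t)) := by
  have hi := integrableOn_weight_Iic hσ.2 b (Real.exp (σ * τ - γ * t)) t
  refine (hg.normS_lpForce_le_integral hQ hL hσ ht hi fun s hs => ?_).trans_eq ?_
  · have := mul_le_mul_of_nonneg_left (hg.normS_le s (hs.trans ht))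
      (Real.exp_pos (γ * (s - t))).le
    rw [← exp_weight]
    linarith
  · rw [integral_const_mul, integral_const_mul, integral_exp_mul_Iic (sub_pos.2 hσ.2),
      ← exp_weight_self γ]
    have : γ - σ ≠ 0 := (sub_pos.2 hσ.2).ne'
    field_simp

lemma movingNorm_lpForce_le (hΓ : IsAdmissible Γ) {t : ℝ} (ht : t ≤ τ) :
    movingNorm L Q Γ γ ρ t (lpForce L Q τ g t)
      ≤ Γ (a / (σ - ρ), b / (γ - σ)) * Real.exp (σ * (τ - t)) := by
  have h := movingNorm_le hΓ (hg.normN_lpForce_le hQ hL hσ ht) (hg.normS_lpForce_le hQ hL hσ ht)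
  rwa [mul_comm (a / _), mul_comm (b / _), IsAdmissible.mul_eq (Real.exp_pos _).le,
    mul_comm] at h

/-- A bound of `lpForce` by the weighted `L¹` norm of the forcing. -/
lemma movingNorm_lpForce_le_integral (hΓ : IsAdmissible Γ)
    (hi : IntegrableOn (fun s => Real.exp (σ * (s - τ)) * ‖g s‖) (Iic τ)) {t : ℝ} (ht : t ≤ τ) :
    movingNorm L Q Γ γ ρ t (lpForce L Q τ g t)
      ≤ Γ (M, M) * (∫ s in Iic τ, Real.exp (σ * (s - τ)) * ‖g s‖)
        * Real.exp (σ * (τ - t)) := by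
  set I := ∫ s in Iic τ, Real.exp (σ * (s - τ)) * ‖g s‖ with hI
  have hM := hQ.M_nonneg
  have hi' : IntegrableOn (fun s => Real.exp (σ * (τ - t)) * M *
      (Real.exp (σ * (s - τ)) * ‖g s‖)) (Iic τ) := hi.const_mul (Real.exp (σ * (τ - t)) * M)
  have hpos : ∀ s, 0 ≤ Real.exp (σ * (τ - t)) * M * (Real.exp (σ * (s - τ)) * ‖g s‖) :=
    fun s => by positivity
  have hint : ∫ s in Iic τ, Real.exp (σ * (τ - t)) * M * (Real.exp (σ * (s - τ)) * ‖g s‖)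
      = Real.exp (σ * (τ - t)) * I * M := by
    rw [integral_const_mul, ← hI]; ring
  -- Used with c = ρ for s ≥ t and with c = γ for s ≤ t: on its own side of t each kernel is
  -- dominated by the σ-weight.
  have hexp : ∀ c s, c * (s - t) ≤ σ * (s - t) → Real.exp (c * (s - t)) * (M * ‖g s‖)
      ≤ Real.exp (σ * (τ - t)) * M * (Real.exp (σ * (s - τ)) * ‖g s‖) := by
    intro c s hc
    rw [show Real.exp (σ * (τ - t)) * M * (Real.exp (σ * (s - τ)) * ‖g s‖)
      = (Real.exp (σ * (τ - t)) * Real.exp (σ * (s - τ))) * (M * ‖g s‖) by ring,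
      ← Real.exp_add]
    gcongr
    linarith
  have hN : normN L Q ρ t (Q t (lpForce L Q τ g t)) ≤ Real.exp (σ * (τ - t)) * I * M := by
    refine (hg.normN_lpForce_le_integral hQ hL hσ ht (hi'.mono_set Ioc_subset_Iic_self)
      fun s hs => ?_).trans ((setIntegral_mono_set hi' (.of_forall hpos)
        Ioc_subset_Iic_self.eventuallyLE).trans_eq hint)
    refine le_trans ?_ (hexp ρ s (mul_le_mul_of_nonneg_right hσ.1.le (by linarith [hs.1])))
    gcongr
    exact normN_proj_le_norm hQ hL s _
  have hS : normS L γ t (complProj Q t (lpForce L Q τ g t))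
      ≤ Real.exp (σ * (τ - t)) * I * M := by
    refine (hg.normS_lpForce_le_integral hQ hL hσ ht (hi'.mono_set (Iic_subset_Iic.2 ht))
      fun s hs => ?_).trans ((setIntegral_mono_set hi' (.of_forall hpos)
        (Iic_subset_Iic.2 ht).eventuallyLE).trans_eq hint)
    refine le_trans ?_ (hexp γ s (mul_le_mul_of_nonpos_right hσ.2.le (by linarith)))
    gcongr
    exact normS_complProj_le_norm hQ s _
  have hI0 : 0 ≤ I := setIntegral_nonneg measurableSet_Iic fun s _ => by positivity
  have h := movingNorm_le hΓ hN hS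
  rw [IsAdmissible.mul_eq (by positivity)] at h
  linarith

end components

section continuity

variable (hQ : HasExponentialSplitting L Q M γ ρ) (hL : IsLinearEvolutionProcess L)
  (hσ : σ ∈ Ioo ρ γ) (hg : IsForcing L Q γ ρ σ τ a b g)

include hQ hL hg hσ

lemma continuousOn_integral_unstable :
    ContinuousOn (fun t => ∫ s in Ioc t τ, unstableOp L Q t s (g s)) (Iic τ) := by
  intro t₀ ht₀
  have ha := hg.nonneg_left
  have hnear : ∀ᶠ t in 𝓝[Iic τ] t₀, t₀ - 1 ≤ t ∧ t ≤ τ := by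
    filter_upwards [self_mem_nhdsWithin,
      mem_nhdsWithin_of_mem_nhds (Ici_mem_nhds (by linarith : t₀ - 1 < t₀))] with t h1 h2
    exact ⟨h2, h1⟩
  have hexp : ∀ᶠ t in 𝓝[Iic τ] t₀,
      Real.exp (σ * τ - ρ * t) ≤ Real.exp (σ * τ - ρ * t₀) + 1 := by
    have h : Tendsto (fun t => Real.exp (σ * τ - ρ * t)) (𝓝[Iic τ] t₀)
        (𝓝 (Real.exp (σ * τ - ρ * t₀))) :=
      (Continuous.tendsto (by fun_prop) t₀).mono_left nhdsWithin_le_nhds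
    exact h.eventually_le_const (lt_add_one _)
  -- Indicators move the varying limit of integration into the integrand over a fixed interval, so
  -- that dominated convergence applies.
  have heq : ∀ t, t₀ - 1 ≤ t → ∫ s in Ioc t τ, unstableOp L Q t s (g s)
      = ∫ s in Ioc (t₀ - 1) τ, (Ioi t).indicator (fun s => unstableOp L Q t s (g s)) s := by
    intro t ht
    rw [setIntegral_indicator measurableSet_Ioi, Ioc_inter_Ioi, sup_eq_right.2 ht]
  have hkey : Tendsto
      (fun t => ∫ s in Ioc (t₀ - 1) τ, (Ioi t).indicator (fun s => unstableOp L Q t s (g s)) s)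
      (𝓝[Iic τ] t₀)
      (𝓝 (∫ s in Ioc (t₀ - 1) τ,
        (Ioi t₀).indicator (fun s => unstableOp L Q t₀ s (g s)) s)) := by
    refine tendsto_integral_filter_of_dominated_convergence
      (fun s => a * ((Real.exp (σ * τ - ρ * t₀) + 1) * Real.exp ((ρ - σ) * s))) ?_ ?_ ?_ ?_
    · filter_upwards [hnear] with t ht
      rw [aestronglyMeasurable_indicator_iff measurableSet_Ioi,
        Measure.restrict_restrict measurableSet_Ioi]
      exact hQ.aestronglyMeasurable_unstableOp hL (measurableSet_Ioi.inter measurableSet_Ioc)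
        (fun s hs => le_of_lt hs.1) (hg.meas.mono_set fun s hs => hs.2.2)
    · filter_upwards [hexp] with t ht
      filter_upwards [ae_restrict_mem measurableSet_Ioc] with s hs
      by_cases hts : s ∈ Ioi t
      · rw [indicator_of_mem hts]
        refine (hg.norm_unstable_le hQ hL (le_of_lt hts) hs.2).trans ?_
        gcongr
      · rw [indicator_of_notMem hts, norm_zero]
        positivity
    · exact (integrableOn_weight_Ioi hσ.1 a _ (t₀ - 1)).mono_set Ioc_subset_Ioi_self
    -- The integrand may jump in t only at s = t₀, a null set.
    · filter_upwards [ae_restrict_mem measurableSet_Ioc,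
        ae_restrict_of_ae (Measure.ae_ne volume t₀)] with s hs hne
      rcases hne.lt_or_gt with hlt | hgt
      · rw [indicator_of_notMem (by simpa using hlt.le)]
        refine tendsto_const_nhds.congr' ?_
        filter_upwards [mem_nhdsWithin_of_mem_nhds (Ioi_mem_nhds hlt)] with t ht
        rw [indicator_of_notMem (by simpa using le_of_lt ht)]
      · rw [indicator_of_mem (by simpa using hgt)]
        have h1 : Tendsto (fun t => unstableOp L Q t s (g s)) (𝓝[Iic τ] t₀)
            (𝓝 (unstableOp L Q t₀ s (g s))) :=
          ((hQ.continuousOn_unstableOp_left hL s (g s)).continuousAt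
            (Iic_mem_nhds hgt)).mono_left nhdsWithin_le_nhds
        refine h1.congr' ?_
        filter_upwards [mem_nhdsWithin_of_mem_nhds (Iio_mem_nhds hgt)] with t ht
        rw [indicator_of_mem (by simpa using ht)]
  rw [ContinuousWithinAt, heq t₀ (by linarith)]
  refine hkey.congr' ?_
  filter_upwards [hnear] with t ht
  exact (heq t ht.1).symm

lemma continuousOn_integral_stable :
    ContinuousOn (fun t => ∫ s in Iic t, L t s (complProj Q s (g s))) (Iic τ) := by
  intro t₀ ht₀
  have hb := hg.nonneg_right
  have hexp : ∀ᶠ t in 𝓝[Iic τ] t₀,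
      Real.exp (σ * τ - γ * t) ≤ Real.exp (σ * τ - γ * t₀) + 1 := by
    have h : Tendsto (fun t => Real.exp (σ * τ - γ * t)) (𝓝[Iic τ] t₀)
        (𝓝 (Real.exp (σ * τ - γ * t₀))) :=
      (Continuous.tendsto (by fun_prop) t₀).mono_left nhdsWithin_le_nhds
    exact h.eventually_le_const (lt_add_one _)
  have heq : ∀ t ≤ τ, ∫ s in Iic t, L t s (complProj Q s (g s))
      = ∫ s in Iic τ, (Iic t).indicator (fun s => L t s (complProj Q s (g s))) s := by
    intro t ht
    rw [setIntegral_indicator measurableSet_Iic, Iic_inter_Iic, inf_eq_right.2 ht]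
  have hkey : Tendsto
      (fun t => ∫ s in Iic τ, (Iic t).indicator (fun s => L t s (complProj Q s (g s))) s)
      (𝓝[Iic τ] t₀)
      (𝓝 (∫ s in Iic τ, (Iic t₀).indicator (fun s => L t₀ s (complProj Q s (g s))) s)) := by
    refine tendsto_integral_filter_of_dominated_convergence
      (fun s => b * ((Real.exp (σ * τ - γ * t₀) + 1) * Real.exp ((γ - σ) * s))) ?_ ?_ ?_ ?_
    · refine .of_forall fun t => ?_
      rw [aestronglyMeasurable_indicator_iff measurableSet_Iic,
        Measure.restrict_restrict measurableSet_Iic]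
      exact hQ.aestronglyMeasurable_stable hL (measurableSet_Iic.inter measurableSet_Iic)
        (fun s hs => hs.1) (hg.meas.mono_set fun s hs => hs.2)
    · filter_upwards [hexp] with t ht
      filter_upwards [ae_restrict_mem measurableSet_Iic] with s hs
      by_cases hts : s ∈ Iic t
      · rw [indicator_of_mem hts]
        refine (hg.norm_stable_le hQ hts hs).trans ?_
        gcongr
      · rw [indicator_of_notMem hts, norm_zero]
        positivity
    · exact integrableOn_weight_Iic hσ.2 b _ τ
    · filter_upwards [ae_restrict_of_ae (Measure.ae_ne volume t₀)] with s hne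
      rcases hne.lt_or_gt with hlt | hgt
      · rw [indicator_of_mem (by simpa using hlt.le)]
        have h1 : Tendsto (fun t => L t s (complProj Q s (g s))) (𝓝[Iic τ] t₀)
            (𝓝 (L t₀ s (complProj Q s (g s)))) :=
          ((HasExponentialSplitting.continuousOn_evol_left hL s _).continuousAt
            (Ici_mem_nhds hlt)).mono_left nhdsWithin_le_nhds
        refine h1.congr' ?_
        filter_upwards [mem_nhdsWithin_of_mem_nhds (Ioi_mem_nhds hlt)] with t ht
        rw [indicator_of_mem (by simpa using le_of_lt ht)]
      · rw [indicator_of_notMem (by simpa using hgt)]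
        refine tendsto_const_nhds.congr' ?_
        filter_upwards [mem_nhdsWithin_of_mem_nhds (Iio_mem_nhds hgt)] with t ht
        rw [indicator_of_notMem (by simpa using ht)]
  rw [ContinuousWithinAt, heq t₀ ht₀]
  refine hkey.congr' ?_
  filter_upwards [self_mem_nhdsWithin] with t ht
  exact (heq t ht).symm

lemma continuousOn_lpForce : ContinuousOn (lpForce L Q τ g) (Iic τ) :=
  (hg.continuousOn_integral_unstable hQ hL hσ).neg.add
    (hg.continuousOn_integral_stable hQ hL hσ)

end continuity

end IsForcing

end InertialManifold

/-! ### The Lyapunov–Perron fixed point -/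

namespace InertialManifold

open Filter Topology

variable {X : Type*} [NormedAddCommGroup X] [NormedSpace ℝ X]
  {L : ℝ → ℝ → X →L[ℝ] X} {Q : ℝ → X →L[ℝ] X} {M γ ρ : ℝ} {Γ : Seminorm ℝ (ℝ × ℝ)}
  {σ τ K K' L₁ L₂ : ℝ} {g : ℝ → X → X} {y y' : ℝ → X}

/-- `‖y(t)‖_t ≤ K e^{σ(τ-t)}` for `t ≤ τ`. -/
def IsWeightBounded (L : ℝ → ℝ → X →L[ℝ] X) (Q : ℝ → X →L[ℝ] X) (Γ : Seminorm ℝ (ℝ × ℝ))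
    (γ ρ σ τ K : ℝ) (y : ℝ → X) : Prop :=
  ∀ t ≤ τ, movingNorm L Q Γ γ ρ t (y t) ≤ K * Real.exp (σ * (τ - t))

namespace IsWeightBounded

lemma nonneg (h : IsWeightBounded L Q Γ γ ρ σ τ K y) : 0 ≤ K := by
  simpa using (movingNorm_nonneg _ _).trans (h τ le_rfl)

lemma congr (h : IsWeightBounded L Q Γ γ ρ σ τ K y) (hy : EqOn y y' (Iic τ)) :
    IsWeightBounded L Q Γ γ ρ σ τ K y' := fun t ht => by
  rw [← hy ht]; exact h t ht

lemma mono (h : IsWeightBounded L Q Γ γ ρ σ τ K y) (hK : K ≤ K') :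
    IsWeightBounded L Q Γ γ ρ σ τ K' y := fun t ht =>
  (h t ht).trans (by gcongr)

lemma mono_exponent {σ' : ℝ} (h : IsWeightBounded L Q Γ γ ρ σ τ K y) (hσ : σ ≤ σ') :
    IsWeightBounded L Q Γ γ ρ σ' τ K y := fun t ht =>
  (h t ht).trans (by
    have := h.nonneg
    have := sub_nonneg.2 ht
    gcongr)

lemma add (hQ : HasExponentialSplitting L Q M γ ρ) (hΓ : IsAdmissible Γ)
    (h : IsWeightBounded L Q Γ γ ρ σ τ K y) (h' : IsWeightBounded L Q Γ γ ρ σ τ K' y') :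
    IsWeightBounded L Q Γ γ ρ σ τ (K + K') (fun t => y t + y' t) := fun t ht => by
  rw [add_mul]
  exact (movingNorm_add_le hQ hΓ t _ _).trans (add_le_add (h t ht) (h' t ht))

lemma smul (h : IsWeightBounded L Q Γ γ ρ σ τ K y) (c : ℝ) :
    IsWeightBounded L Q Γ γ ρ σ τ (|c| * K) (fun t => c • y t) := fun t ht => by
  rw [movingNorm_smul, mul_assoc]
  exact mul_le_mul_of_nonneg_left (h t ht) (abs_nonneg c)

lemma sub (hQ : HasExponentialSplitting L Q M γ ρ) (hΓ : IsAdmissible Γ)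
    (h : IsWeightBounded L Q Γ γ ρ σ τ K y) (h' : IsWeightBounded L Q Γ γ ρ σ τ K' y') :
    IsWeightBounded L Q Γ γ ρ σ τ (K + K') (fun t => y t - y' t) := by
  simpa [sub_eq_add_neg] using h.add hQ hΓ (h'.smul (-1))

lemma norm_le (hQ : HasExponentialSplitting L Q M γ ρ) (hL : IsLinearEvolutionProcess L)
    (hΓ : IsAdmissible Γ) (h : IsWeightBounded L Q Γ γ ρ σ τ K y) {t : ℝ} (ht : t ≤ τ) :
    ‖y t‖ ≤ ((Γ (1, 0))⁻¹ + (Γ (0, 1))⁻¹) * K * Real.exp (σ * (τ - t)) := by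
  rw [mul_assoc]
  refine (norm_le_movingNorm hQ hL hΓ t (y t)).trans
    (mul_le_mul_of_nonneg_left (h t ht) ?_)
  have := hΓ.pos_left
  have := hΓ.pos_right
  positivity

/-- A bounded function whose bound is improved by an affine contraction. -/
lemma of_contraction (h : IsWeightBounded L Q Γ γ ρ σ τ K y) {κ D : ℝ} (hκ : κ < 1)
    (hc : ∀ K, IsWeightBounded L Q Γ γ ρ σ τ K y →
      IsWeightBounded L Q Γ γ ρ σ τ (κ * K + D) y) :
    IsWeightBounded L Q Γ γ ρ σ τ (D / (1 - κ)) y := by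
  set S := {K | IsWeightBounded L Q Γ γ ρ σ τ K y}
  have hbdd : BddBelow S := ⟨0, fun K hK => hK.nonneg⟩
  have hmem : sInf S ∈ S := by
    -- The least bound is attained, since the bound is a family of closed conditions on K; improving
    -- it once yields K ≤ κK + D.
    intro t ht
    rw [← div_le_iff₀ (Real.exp_pos _)]
    exact le_csInf ⟨K, h⟩ fun K' hK' => (div_le_iff₀ (Real.exp_pos _)).2 (hK' t ht)
  have h1 := csInf_le hbdd (hc _ hmem)
  refine mono hmem ?_
  rw [le_div_iff₀ (by linarith)]
  linarith

end IsWeightBounded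

lemma memE_iff : MemE L Q Γ γ ρ σ τ y ↔
    ContinuousOn y (Iic τ) ∧ ∃ K, IsWeightBounded L Q Γ γ ρ σ τ K y := by
  have key : ∀ K t, Real.exp (σ * (t - τ)) * movingNorm L Q Γ γ ρ t (y t) ≤ K ↔
      movingNorm L Q Γ γ ρ t (y t) ≤ K * Real.exp (σ * (τ - t)) := by
    intro K t
    rw [show σ * (τ - t) = -(σ * (t - τ)) by ring, Real.exp_neg, ← div_eq_mul_inv,
      le_div_iff₀ (Real.exp_pos _), mul_comm]
  refine and_congr_right fun _ => exists_congr fun K => ⟨fun h t ht => ?_, ?_⟩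
  · exact (key K t).1 (h ⟨⟨t, ht⟩, rfl⟩)
  · rintro h _ ⟨t, rfl⟩
    exact (key K t).2 (h t t.2)

/-- Nonlinearities for which the Lyapunov–Perron map on `(-∞,τ]` is well behaved. -/
structure IsLipNonlinearity (L : ℝ → ℝ → X →L[ℝ] X) (Q : ℝ → X →L[ℝ] X)
    (Γ : Seminorm ℝ (ℝ × ℝ)) (γ ρ τ L₁ L₂ : ℝ) (g : ℝ → X → X) : Prop where
  zero : ∀ s, g s 0 = 0
  normN_le : ∀ s u v, normN L Q ρ s (Q s (g s u - g s v)) ≤ L₁ * movingNorm L Q Γ γ ρ s (u - v)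
  normS_le : ∀ s u v,
    normS L γ s (complProj Q s (g s u - g s v)) ≤ L₂ * movingNorm L Q Γ γ ρ s (u - v)
  meas : ∀ u : ℝ → X, ContinuousOn u (Iic τ) →
    AEStronglyMeasurable (fun s => g s (u s)) (volume.restrict (Iic τ))

lemma lpMap_eq (η : X) (z : ℝ → X) (t : ℝ) :
    lpMap L Q g τ η z t = unstableOp L Q t τ η + lpForce L Q τ (fun s => g s (z s)) t := by
  rw [lpMap, lpForce, sub_eq_add_neg, add_assoc]

namespace IsLipNonlinearity

variable (hg : IsLipNonlinearity L Q Γ γ ρ τ L₁ L₂ g) (hL₁ : 0 < L₁) (hL₂ : 0 < L₂)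
include hg hL₁ hL₂

lemma isForcing_sub (hy : ContinuousOn y (Iic τ)) (hy' : ContinuousOn y' (Iic τ))
    (h : IsWeightBounded L Q Γ γ ρ σ τ K (fun t => y t - y' t)) :
    IsForcing L Q γ ρ σ τ (L₁ * K) (L₂ * K) (fun s => g s (y s) - g s (y' s)) where
  meas := (hg.meas y hy).sub (hg.meas y' hy')
  normN_le s hs := (hg.normN_le s _ _).trans <| by
    rw [mul_assoc]; exact mul_le_mul_of_nonneg_left (h s hs) hL₁.le
  normS_le s hs := (hg.normS_le s _ _).trans <| by
    rw [mul_assoc]; exact mul_le_mul_of_nonneg_left (h s hs) hL₂.le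

lemma isForcing (hy : ContinuousOn y (Iic τ)) (h : IsWeightBounded L Q Γ γ ρ σ τ K y) :
    IsForcing L Q γ ρ σ τ (L₁ * K) (L₂ * K) (fun s => g s (y s)) := by
  have := hg.isForcing_sub hL₁ hL₂ hy (continuousOn_const (c := 0)) (by simpa using h)
  simpa [hg.zero] using this

end IsLipNonlinearity

/-- Homogeneity of Γ takes K out; this is where the contraction factor arises. -/
lemma IsForcing.isWeightBounded_lpForce [CompleteSpace X]
    (hQ : HasExponentialSplitting L Q M γ ρ) (hL : IsLinearEvolutionProcess L)
    (hΓ : IsAdmissible Γ) (hσ : σ ∈ Ioo ρ γ) {h : ℝ → X} (hK : 0 ≤ K)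
    (hh : IsForcing L Q γ ρ σ τ (L₁ * K) (L₂ * K) h) :
    IsWeightBounded L Q Γ γ ρ σ τ (Γ (L₁ / (σ - ρ), L₂ / (γ - σ)) * K)
      (lpForce L Q τ h) := fun t ht => by
  have := hh.movingNorm_lpForce_le hQ hL hσ hΓ ht
  rwa [mul_comm L₁, mul_comm L₂, mul_div_assoc, mul_div_assoc, IsAdmissible.mul_eq hK,
    mul_comm K] at this

lemma isWeightBounded_unstableOp (hQ : HasExponentialSplitting L Q M γ ρ)
    (hL : IsLinearEvolutionProcess L) (hΓ : IsAdmissible Γ) (hσ : ρ ≤ σ) (ξ : X) :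
    IsWeightBounded L Q Γ γ ρ σ τ (Γ (M, M) * ‖ξ‖) (fun t => unstableOp L Q t τ ξ) := by
  intro t ht
  have hM := hQ.M_nonneg
  have h1 : normN L Q ρ t (Q t (unstableOp L Q t τ ξ)) ≤ Real.exp (σ * (τ - t)) * ‖ξ‖ * M := by
    refine normN_proj_le fun r hr => ?_
    rw [hQ.proj_unstableOp hL ht, hQ.unstableOp_unstableOp hL hr ht]
    have h2 := exp_mul_unstableOp_le hQ (hr.trans ht) ξ
    calc Real.exp (ρ * (r - t)) * ‖unstableOp L Q r τ ξ‖
        = Real.exp (ρ * (τ - t)) * (Real.exp (ρ * (r - τ)) * ‖unstableOp L Q r τ ξ‖) := by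
          rw [← mul_assoc, ← Real.exp_add]; ring_nf
      _ ≤ Real.exp (σ * (τ - t)) * (M * ‖ξ‖) := by
          have := sub_nonneg.2 ht
          gcongr
      _ = _ := by ring
  have h3 : normS L γ t (complProj Q t (unstableOp L Q t τ ξ))
      ≤ Real.exp (σ * (τ - t)) * ‖ξ‖ * M := by
    refine normS_complProj_le fun r hr => ?_
    rw [hQ.complProj_unstableOp hL ht, map_zero, norm_zero, mul_zero]
    positivity
  have h := movingNorm_le hΓ h1 h3
  rw [IsAdmissible.mul_eq (by positivity)] at h
  linarith

section fixedPoint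

variable [CompleteSpace X] (hQ : HasExponentialSplitting L Q M γ ρ)
  (hL : IsLinearEvolutionProcess L) (hΓ : IsAdmissible Γ) (hσ : σ ∈ Ioo ρ γ)
  (hg : IsLipNonlinearity L Q Γ γ ρ τ L₁ L₂ g) (hL₁ : 0 < L₁) (hL₂ : 0 < L₂)
include hQ hL hΓ hσ hg hL₁ hL₂

/-- Membership in E makes all integrals converge, so the difference of the two images is the
homogeneous orbit of η - η' plus the force of a Lipschitz difference. The case η = η' is the
contraction property. -/
lemma isWeightBounded_lpMap_sub (η η' : X) (hy : MemE L Q Γ γ ρ σ τ y)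
    (hy' : MemE L Q Γ γ ρ σ τ y')
    (h : IsWeightBounded L Q Γ γ ρ σ τ K (fun t => y t - y' t)) :
    IsWeightBounded L Q Γ γ ρ σ τ
      (Γ (M, M) * ‖η - η'‖ + Γ (L₁ / (σ - ρ), L₂ / (γ - σ)) * K)
      (fun t => lpMap L Q g τ η y t - lpMap L Q g τ η' y' t) := by
  rw [memE_iff] at hy hy'
  obtain ⟨hy, B, hB⟩ := hy
  obtain ⟨hy', B', hB'⟩ := hy'
  refine ((isWeightBounded_unstableOp hQ hL hΓ hσ.1.le (η - η')).add hQ hΓ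
    ((hg.isForcing_sub hL₁ hL₂ hy hy' h).isWeightBounded_lpForce hQ hL hΓ hσ
      h.nonneg)).congr fun t ht => ?_
  change _ + _ = _ - _
  rw [lpMap_eq, lpMap_eq, (hg.isForcing hL₁ hL₂ hy hB).lpForce_sub hQ hL hσ
    (hg.isForcing hL₁ hL₂ hy' hB') ht, map_sub]
  abel

lemma memE_lpMap (η : X) (hy : MemE L Q Γ γ ρ σ τ y) :
    MemE L Q Γ γ ρ σ τ (lpMap L Q g τ η y) := by
  rw [memE_iff] at hy ⊢
  obtain ⟨hy, B, hB⟩ := hy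
  have hF := hg.isForcing hL₁ hL₂ hy hB
  refine ⟨?_, _, (((isWeightBounded_unstableOp hQ hL hΓ hσ.1.le η).add hQ hΓ
    (hF.isWeightBounded_lpForce hQ hL hΓ hσ hB.nonneg))).congr fun t _ =>
      (lpMap_eq η y t).symm⟩
  exact ((hQ.continuousOn_unstableOp_left hL τ η).add
    (hF.continuousOn_lpForce hQ hL hσ)).congr fun t _ => lpMap_eq η y t

variable (hgap : Γ (L₁ / (σ - ρ), L₂ / (γ - σ)) < 1)
include hgap

/-- The difference has some finite weighted bound K, which the fixed-point equations improve to κK +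
Γ(M,M)‖η - η'‖. This gives both uniqueness and Lipschitz dependence on η. -/
lemma isWeightBounded_fixedPoint_sub {η η' : X} (hy : MemE L Q Γ γ ρ σ τ y)
    (hy' : MemE L Q Γ γ ρ σ τ y') (hfix : ∀ t ≤ τ, lpMap L Q g τ η y t = y t)
    (hfix' : ∀ t ≤ τ, lpMap L Q g τ η' y' t = y' t) :
    IsWeightBounded L Q Γ γ ρ σ τ
      (Γ (M, M) * ‖η - η'‖ / (1 - Γ (L₁ / (σ - ρ), L₂ / (γ - σ))))
      (fun t => y t - y' t) := by
  obtain ⟨-, B, hB⟩ := memE_iff.1 hy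
  obtain ⟨-, B', hB'⟩ := memE_iff.1 hy'
  refine (hB.sub hQ hΓ hB').of_contraction hgap fun K hK => ?_
  rw [add_comm]
  refine (isWeightBounded_lpMap_sub hQ hL hΓ hσ hg hL₁ hL₂ η η' hy hy' hK).congr fun t ht => ?_
  change _ - _ = _ - _
  rw [hfix t ht, hfix' t ht]

lemma fixedPoint_unique {η : X} (hy : MemE L Q Γ γ ρ σ τ y)
    (hy' : MemE L Q Γ γ ρ σ τ y') (hfix : ∀ t ≤ τ, lpMap L Q g τ η y t = y t)
    (hfix' : ∀ t ≤ τ, lpMap L Q g τ η y' t = y' t) : EqOn y y' (Iic τ) := by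
  intro t ht
  have h := (isWeightBounded_fixedPoint_sub hQ hL hΓ hσ hg hL₁ hL₂ hgap hy hy' hfix
    hfix').norm_le hQ hL hΓ ht
  simp only [sub_self, norm_zero, mul_zero, zero_div, zero_mul] at h
  exact sub_eq_zero.1 (norm_le_zero_iff.1 h)

open scoped BoundedContinuousFunction in
-- Completeness is borrowed from the bounded continuous functions on (-∞,τ], identified with E by
-- the exponential weight. Their sup metric is only equivalent to the weighted moving norm, so the
-- contraction principle is applied to an iterate.
lemma exists_fixedPoint (η : X) :
    ∃ z, MemE L Q Γ γ ρ σ τ z ∧ ∀ t ≤ τ, lpMap L Q g τ η z t = z t := by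
  set κ := Γ (L₁ / (σ - ρ), L₂ / (γ - σ)) with hκ
  have hκ0 : 0 ≤ κ := apply_nonneg Γ _
  set c := (Γ (1, 0))⁻¹ + (Γ (0, 1))⁻¹ with hc
  have hc0 : 0 ≤ c := by
    have := hΓ.pos_left
    have := hΓ.pos_right
    positivity
  have hexp : ∀ t, Real.exp (σ * (t - τ)) * Real.exp (σ * (τ - t)) = 1 := fun t => by
    rw [← Real.exp_add, Real.exp_eq_one_iff]; ring
  -- Evaluation at min(t,τ) extends the curve continuously beyond τ.
  let E : (Iic τ →ᵇ X) → ℝ → X := fun w t =>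
    Real.exp (σ * (τ - t)) • w ⟨min t τ, mem_Iic.2 (min_le_right _ _)⟩
  have hE : ∀ w t (ht : t ≤ τ), E w t = Real.exp (σ * (τ - t)) • w ⟨t, ht⟩ := fun w t ht => by
    simp only [E, min_eq_left ht]
  have hEcont : ∀ w, Continuous (E w) := fun w =>
    (by fun_prop : Continuous fun t => Real.exp (σ * (τ - t))).smul
      (w.continuous.comp (by fun_prop))
  have hEbound : ∀ w w', IsWeightBounded L Q Γ γ ρ σ τ (Γ (M, M) * dist w w')
      (fun t => E w t - E w' t) := by
    intro w w' t ht
    change movingNorm L Q Γ γ ρ t (E w t - E w' t) ≤ _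
    rw [hE w t ht, hE w' t ht, ← smul_sub, movingNorm_smul, abs_of_pos (Real.exp_pos _), mul_comm]
    gcongr
    refine (movingNorm_le_norm hQ hL hΓ t _).trans ?_
    rw [← dist_eq_norm]
    gcongr
    exact BoundedContinuousFunction.dist_coe_le_dist _
  have hEmem : ∀ w, MemE L Q Γ γ ρ σ τ (E w) := fun w =>
    memE_iff.2 ⟨(hEcont w).continuousOn, _, (hEbound w 0).congr fun t _ => by simp [E]⟩
  have hEdist : ∀ w w' K, IsWeightBounded L Q Γ γ ρ σ τ K (fun t => E w t - E w' t) →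
      dist w w' ≤ c * K := by
    intro w w' K hK
    refine (BoundedContinuousFunction.dist_le (mul_nonneg hc0 hK.nonneg)).2 fun t => ?_
    have h1 := hK.norm_le hQ hL hΓ t.2
    rw [hE w t t.2, hE w' t t.2, ← smul_sub, norm_smul, Real.norm_of_nonneg (Real.exp_pos _).le,
      mul_comm] at h1
    rw [dist_eq_norm]
    exact le_of_mul_le_mul_right h1 (Real.exp_pos _)
  have hEsurj : ∀ z, MemE L Q Γ γ ρ σ τ z → ∃ w, ∀ t ≤ τ, E w t = z t := by
    intro z hz
    obtain ⟨hz, K, hK⟩ := memE_iff.1 hz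
    refine ⟨BoundedContinuousFunction.ofNormedAddCommGroup
      (fun t : Iic τ => Real.exp (σ * (t - τ)) • z t)
      ((by fun_prop : Continuous fun t : Iic τ => Real.exp (σ * ((t : ℝ) - τ))).smul
        (continuousOn_iff_continuous_domRestrict.1 hz)) (c * K) fun t => ?_, fun t ht => ?_⟩
    · rw [norm_smul, Real.norm_of_nonneg (Real.exp_pos _).le]
      have h1 := mul_le_mul_of_nonneg_left (hK.norm_le hQ hL hΓ t.2)
        (Real.exp_pos (σ * (t - τ))).le
      rwa [mul_left_comm, hexp, mul_one] at h1
    · rw [hE _ t ht]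
      simp only [BoundedContinuousFunction.coe_ofNormedAddCommGroup]
      rw [smul_smul, mul_comm, hexp, one_smul]
  choose T hT using fun w => hEsurj _ (memE_lpMap hQ hL hΓ hσ hg hL₁ hL₂ η (hEmem w))
  have hcontr : ∀ w w' K, IsWeightBounded L Q Γ γ ρ σ τ K (fun t => E w t - E w' t) →
      IsWeightBounded L Q Γ γ ρ σ τ (κ * K) (fun t => E (T w) t - E (T w') t) := by
    intro w w' K hK
    have h1 := isWeightBounded_lpMap_sub hQ hL hΓ hσ hg hL₁ hL₂ η η (hEmem w) (hEmem w') hK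
    rw [sub_self, norm_zero, mul_zero, zero_add] at h1
    refine h1.congr fun t ht => ?_
    change _ - _ = _ - _
    rw [hT w t ht, hT w' t ht]
  have hiter : ∀ n w w', IsWeightBounded L Q Γ γ ρ σ τ (κ ^ n * (Γ (M, M) * dist w w'))
      (fun t => E (T^[n] w) t - E (T^[n] w') t) := by
    intro n w w'
    induction n with
    | zero => simpa using hEbound w w'
    | succ n ih =>
      rw [Function.iterate_succ_apply', Function.iterate_succ_apply', pow_succ', mul_assoc]
      exact hcontr _ _ _ ih
  -- For large n the factor κ^n absorbs both equivalence constants, c and Γ(M,M).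
  obtain ⟨n, hn⟩ : ∃ n, c * (κ ^ n * Γ (M, M)) < 1 := by
    have h1 : Tendsto (fun n => c * (κ ^ n * Γ (M, M))) atTop (𝓝 (c * (0 * Γ (M, M)))) :=
      ((tendsto_pow_atTop_nhds_zero_of_lt_one hκ0 hgap).mul_const _).const_mul c
    rw [zero_mul, mul_zero] at h1
    exact (h1.eventually_lt_const zero_lt_one).exists
  have hk0 : 0 ≤ c * (κ ^ n * Γ (M, M)) :=
    mul_nonneg hc0 (mul_nonneg (pow_nonneg hκ0 n) (apply_nonneg Γ _))
  have hlip : ContractingWith ⟨c * (κ ^ n * Γ (M, M)), hk0⟩ T^[n] := by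
    refine ⟨by exact_mod_cast hn, LipschitzWith.of_dist_le_mul fun w w' => ?_⟩
    refine (hEdist _ _ _ (hiter n w w')).trans_eq ?_
    change _ = c * (κ ^ n * Γ (M, M)) * dist w w'
    ring
  -- The unique fixed point of an iterate is fixed by the map itself.
  have hfix := hlip.isFixedPt_fixedPoint_iterate
  exact ⟨_, hEmem _, fun t ht => by rw [← hT _ t ht, hfix]⟩

end fixedPoint

end InertialManifold

/-! ### The linearized equation and differentiability in η -/

namespace InertialManifold

open Filter Topology

variable {X : Type*} [NormedAddCommGroup X] [NormedSpace ℝ X]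
  {L : ℝ → ℝ → X →L[ℝ] X} {Q : ℝ → X →L[ℝ] X} {M γ ρ : ℝ} {Γ : Seminorm ℝ (ℝ × ℝ)}
  {σ τ L₁ L₂ : ℝ} {f : ℝ → X → X} {y y' z : ℝ → X} {A : ℝ → X →L[ℝ] X}

lemma IsForcing.norm_le {a b : ℝ} {g : ℝ → X} (hQ : HasExponentialSplitting L Q M γ ρ)
    (hL : IsLinearEvolutionProcess L) (hg : IsForcing L Q γ ρ σ τ a b g) {s : ℝ} (hs : s ≤ τ) :
    ‖g s‖ ≤ (a + b) * Real.exp (σ * (τ - s)) := by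
  rw [← proj_add_complProj (Q := Q) s (g s), add_mul]
  exact (norm_add_le _ _).trans (add_le_add
    ((norm_proj_le_normN hQ hL s _).trans (hg.normN_le s hs))
    ((norm_complProj_le_normS hQ hL s _).trans (hg.normS_le s hs)))

/-- The strict inequality σ < σ' leaves the factor e^{(σ'-σ)s}, integrable at -∞. -/
lemma IsForcing.integrableOn_exp_mul_norm {a b : ℝ} {g : ℝ → X}
    (hQ : HasExponentialSplitting L Q M γ ρ) (hL : IsLinearEvolutionProcess L)
    (hg : IsForcing L Q γ ρ σ τ a b g) {σ' : ℝ} (hσ' : σ < σ') :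
    IntegrableOn (fun s => Real.exp (σ' * (s - τ)) * ‖g s‖) (Iic τ) := by
  refine Integrable.mono' (integrableOn_weight_Iic hσ' (a + b) (Real.exp (σ * τ - σ' * τ)) τ)
    (AEStronglyMeasurable.mul (Continuous.aestronglyMeasurable (by fun_prop)) hg.meas.norm) ?_
  filter_upwards [ae_restrict_mem measurableSet_Iic] with s hs
  rw [norm_mul, norm_norm, Real.norm_of_nonneg (Real.exp_pos _).le, ← exp_weight, mul_left_comm]
  exact mul_le_mul_of_nonneg_left (hg.norm_le hQ hL hs) (Real.exp_pos _).le

lemma tendsto_difference_quotient {F : X → X} {x : X} (h : DifferentiableAt ℝ F x) (v : X) :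
    Tendsto (fun n : ℕ => (n : ℝ) • (F (x + (n : ℝ)⁻¹ • v) - F x)) atTop
      (𝓝 (fderiv ℝ F x v)) :=
  h.hasFDerivAt.lim v (by simpa using tendsto_natCast_atTop_atTop (R := ℝ))

omit [NormedSpace ℝ X] in
lemma continuousOn_uncurry_comp (hf : Continuous fun p : ℝ × X => f p.1 p.2) {I : Set ℝ}
    (hy : ContinuousOn y I) : ContinuousOn (fun s => f s (y s)) I :=
  hf.comp_continuousOn (continuousOn_id.prodMk hy)

section nonlinearity

variable (hf : Continuous fun p : ℝ × X => f p.1 p.2)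
  (hLip₁ : ∀ (t : ℝ) (u v : X),
    normN L Q ρ t (Q t (f t u - f t v)) ≤ L₁ * movingNorm L Q Γ γ ρ t (u - v))
  (hLip₂ : ∀ (t : ℝ) (u v : X),
    normS L γ t (complProj Q t (f t u - f t v)) ≤ L₂ * movingNorm L Q Γ γ ρ t (u - v))
include hf hLip₁ hLip₂

lemma isLipNonlinearity (hf0 : ∀ t : ℝ, f t 0 = 0) :
    IsLipNonlinearity L Q Γ γ ρ τ L₁ L₂ f where
  zero := hf0
  normN_le := hLip₁
  normS_le := hLip₂
  meas _ hu := (continuousOn_uncurry_comp hf hu).aestronglyMeasurable measurableSet_Iic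

/-- Each difference quotient of f(s,·) satisfies the bounds with the same L₁ and L₂, and both bounds
and measurability survive the limit. The linearized equation thus falls under the theory of the
nonlinear one. -/
lemma isLipNonlinearity_fderiv (hQ : HasExponentialSplitting L Q M γ ρ)
    (hdiff : ∀ t : ℝ, Differentiable ℝ (f t)) (hz : ContinuousOn z (Iic τ)) :
    IsLipNonlinearity L Q Γ γ ρ τ L₁ L₂ (fun s => fderiv ℝ (f s) (z s)) where
  zero s := map_zero _
  normN_le s u v := by
    rw [← map_sub]
    set w := u - v
    refine normN_proj_le fun r hr => ?_
    -- For fixed r the term of the supremum is continuous in the vector, so the inequality passes to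
    -- the limit term by term.
    have h1 := (((unstableOp L Q r s ∘L Q s).continuous.tendsto _).comp
      (tendsto_difference_quotient (hdiff s (z s)) w)).norm.const_mul (Real.exp (ρ * (r - s)))
    refine le_of_tendsto h1 ?_
    filter_upwards [eventually_ne_atTop 0] with n hn
    refine (le_normN hQ hr _).trans ?_
    rw [map_smul, normN_smul]
    refine (mul_le_mul_of_nonneg_left (hLip₁ s _ _) (abs_nonneg _)).trans_eq ?_
    rw [add_sub_cancel_left, movingNorm_smul, abs_inv]
    have : |(n : ℝ)| ≠ 0 := by simpa using hn
    field_simp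
  normS_le s u v := by
    rw [← map_sub]
    set w := u - v
    refine normS_complProj_le fun r hr => ?_
    have h1 := (((L r s ∘L complProj Q s).continuous.tendsto _).comp
      (tendsto_difference_quotient (hdiff s (z s)) w)).norm.const_mul (Real.exp (γ * (r - s)))
    refine le_of_tendsto h1 ?_
    filter_upwards [eventually_ne_atTop 0] with n hn
    refine (le_normS hQ hr _).trans ?_
    rw [map_smul, normS_smul]
    refine (mul_le_mul_of_nonneg_left (hLip₂ s _ _) (abs_nonneg _)).trans_eq ?_
    rw [add_sub_cancel_left, movingNorm_smul, abs_inv]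
    have : |(n : ℝ)| ≠ 0 := by simpa using hn
    field_simp
  meas u hu := by
    -- Df is not assumed continuous; measurability comes from a sequence of quotients that are
    -- continuous in s.
    refine aestronglyMeasurable_of_tendsto_ae (ι := ℕ) atTop
      (f := fun n s => (n : ℝ) • (f s (z s + (n : ℝ)⁻¹ • u s) - f s (z s))) (fun n => ?_)
      (.of_forall fun s => tendsto_difference_quotient (hdiff s (z s)) (u s))
    exact (((continuousOn_uncurry_comp hf (hz.add (hu.const_smul _))).sub
      (continuousOn_uncurry_comp hf hz)).const_smul _).aestronglyMeasurable measurableSet_Iic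

end nonlinearity

lemma lpMap_congr {g : ℝ → X → X} (η : X) (h : EqOn y y' (Iic τ)) {t : ℝ} (ht : t ≤ τ) :
    lpMap L Q g τ η y t = lpMap L Q g τ η y' t := by
  have h1 : ∫ s in Ioc t τ, unstableOp L Q t s (g s (y s))
      = ∫ s in Ioc t τ, unstableOp L Q t s (g s (y' s)) :=
    setIntegral_congr_fun measurableSet_Ioc fun s hs => by simp only [h hs.2]
  have h2 : ∫ s in Iic t, L t s (complProj Q s (g s (y s)))
      = ∫ s in Iic t, L t s (complProj Q s (g s (y' s))) :=
    setIntegral_congr_fun measurableSet_Iic fun s hs => by simp only [h (le_trans hs ht)]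
  rw [lpMap, lpMap, h1, h2]

lemma MemE.congr (hy : MemE L Q Γ γ ρ σ τ y) (h : EqOn y y' (Iic τ)) :
    MemE L Q Γ γ ρ σ τ y' := by
  rw [memE_iff] at hy ⊢
  obtain ⟨hy, K, hK⟩ := hy
  exact ⟨hy.congr h.symm, K, hK.congr h⟩

lemma isWeightBounded_zero : IsWeightBounded L Q Γ γ ρ σ τ 0 (fun _ => (0 : X)) :=
  fun t _ => by rw [movingNorm_zero, zero_mul]

lemma memE_zero : MemE L Q Γ γ ρ σ τ (fun _ => (0 : X)) :=
  memE_iff.2 ⟨continuousOn_const, 0, isWeightBounded_zero⟩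

lemma lpMap_zero (t : ℝ) : lpMap L Q (fun s => A s) τ 0 (fun _ => 0) t = 0 := by
  simp [lpMap]

lemma lpMap_smul (c : ℝ) (w : X) (t : ℝ) :
    lpMap L Q (fun s => A s) τ (c • w) (fun s => c • y s) t
      = c • lpMap L Q (fun s => A s) τ w y t := by
  simp only [lpMap, map_smul, integral_smul, smul_add, smul_sub]

section linear

variable [CompleteSpace X] (hQ : HasExponentialSplitting L Q M γ ρ)
  (hL : IsLinearEvolutionProcess L) (hΓ : IsAdmissible Γ) (hσ : σ ∈ Ioo ρ γ)
  (hL₁ : 0 < L₁) (hL₂ : 0 < L₂)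
  (hA : IsLipNonlinearity L Q Γ γ ρ τ L₁ L₂ (fun s => A s))
include hQ hL hΓ hσ hL₁ hL₂ hA

omit [CompleteSpace X] hΓ in
lemma lpMap_add (w w' : X) (hy : MemE L Q Γ γ ρ σ τ y) (hy' : MemE L Q Γ γ ρ σ τ y') {t : ℝ}
    (ht : t ≤ τ) :
    lpMap L Q (fun s => A s) τ (w + w') (fun s => y s + y' s) t
      = lpMap L Q (fun s => A s) τ w y t + lpMap L Q (fun s => A s) τ w' y' t := by
  rw [memE_iff] at hy hy'
  obtain ⟨hy, K, hK⟩ := hy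
  obtain ⟨hy', K', hK'⟩ := hy'
  simp only [lpMap_eq, map_add]
  rw [(hA.isForcing hL₁ hL₂ hy hK).lpForce_add hQ hL hσ (hA.isForcing hL₁ hL₂ hy' hK') ht]
  abel

/-- The fixed points of the linear Lyapunov–Perron map define a family of bounded operators. -/
lemma exists_operator_fixedPoint (hgap : Γ (L₁ / (σ - ρ), L₂ / (γ - σ)) < 1) :
    ∃ Z : ℝ → X →L[ℝ] X, ∀ w, MemE L Q Γ γ ρ σ τ (fun t => Z t w) ∧
      (∀ t ≤ τ, lpMap L Q (fun s => A s) τ w (fun t => Z t w) t = Z t w) ∧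
      IsWeightBounded L Q Γ γ ρ σ τ
        (Γ (M, M) * ‖w‖ / (1 - Γ (L₁ / (σ - ρ), L₂ / (γ - σ)))) (fun t => Z t w) := by
  choose Y hYmem hYfix using
    fun w => exists_fixedPoint hQ hL hΓ hσ hA hL₁ hL₂ hgap w
  have hYbound : ∀ w, IsWeightBounded L Q Γ γ ρ σ τ
      (Γ (M, M) * ‖w‖ / (1 - Γ (L₁ / (σ - ρ), L₂ / (γ - σ)))) (Y w) := fun w => by
    simpa using isWeightBounded_fixedPoint_sub hQ hL hΓ hσ hA hL₁ hL₂ hgap (hYmem w) memE_zero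
      (hYfix w) (η' := 0) (fun t _ => lpMap_zero t)
  -- Sums and multiples of solutions solve the equation with the corresponding datum, so uniqueness
  -- gives linearity.
  have hadd : ∀ w w', EqOn (Y (w + w')) (fun t => Y w t + Y w' t) (Iic τ) := by
    intro w w'
    obtain ⟨h1, K, hK⟩ := memE_iff.1 (hYmem w)
    obtain ⟨h2, K', hK'⟩ := memE_iff.1 (hYmem w')
    refine fixedPoint_unique hQ hL hΓ hσ hA hL₁ hL₂ hgap (hYmem _)
      (memE_iff.2 ⟨h1.add h2, _, hK.add hQ hΓ hK'⟩) (hYfix _) fun t ht => ?_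
    rw [lpMap_add hQ hL hσ hL₁ hL₂ hA w w' (hYmem w) (hYmem w') ht, hYfix w t ht,
      hYfix w' t ht]
  have hsmul : ∀ (c : ℝ) w, EqOn (Y (c • w)) (fun t => c • Y w t) (Iic τ) := by
    intro c w
    obtain ⟨h1, K, hK⟩ := memE_iff.1 (hYmem w)
    refine fixedPoint_unique hQ hL hΓ hσ hA hL₁ hL₂ hgap (hYmem _)
      (memE_iff.2 ⟨h1.const_smul c, _, hK.smul c⟩) (hYfix _) fun t ht => ?_
    rw [lpMap_smul, hYfix w t ht]
  have hop : ∀ t : ℝ, ∃ B : X →L[ℝ] X, t ≤ τ → ∀ w, B w = Y w t := by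
    intro t
    by_cases ht : t ≤ τ
    · refine ⟨LinearMap.mkContinuous
        { toFun := fun w => Y w t
          map_add' := fun w w' => hadd w w' ht
          map_smul' := fun c w => hsmul c w ht }
        (((Γ (1, 0))⁻¹ + (Γ (0, 1))⁻¹) * (Γ (M, M) / (1 - Γ (L₁ / (σ - ρ), L₂ / (γ - σ))))
          * Real.exp (σ * (τ - t))) fun w => ((hYbound w).norm_le hQ hL hΓ ht).trans_eq ?_,
        fun _ w => rfl⟩
      ring
    · exact ⟨0, fun h => absurd h ht⟩
  choose Z hZ using hop
  have hZY : ∀ w, EqOn (Y w) (fun t => Z t w) (Iic τ) := fun w t ht => (hZ t ht w).symm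
  refine ⟨Z, fun w => ⟨(hYmem w).congr (hZY w), fun t ht => ?_, (hYbound w).congr (hZY w)⟩⟩
  rw [← lpMap_congr w (hZY w) ht, hYfix w t ht, hZ t ht w]

end linear

/-- Choose σ' with γ - σ' = (γ - σ)(1+κ)/2. The stable entry grows by the factor 2/(1+κ) while the
unstable one decreases, so the new value of Γ is at most 2κ/(1+κ) < 1. -/
lemma exists_larger_exponent (hσ : σ ∈ Ioo ρ γ) (hΓ : IsAdmissible Γ) (hL₁ : 0 < L₁)
    (hL₂ : 0 < L₂) (hgap : Γ (L₁ / (σ - ρ), L₂ / (γ - σ)) < 1) :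
    ∃ σ' ∈ Ioo ρ γ, σ < σ' ∧ Γ (L₁ / (σ' - ρ), L₂ / (γ - σ')) < 1 := by
  set κ := Γ (L₁ / (σ - ρ), L₂ / (γ - σ)) with hκ
  have hκ0 : 0 ≤ κ := apply_nonneg Γ _
  have h1 : 0 < γ - σ := sub_pos.2 hσ.2
  have h2 : 0 < σ - ρ := sub_pos.2 hσ.1
  have h3 : γ - (γ - (γ - σ) * ((1 + κ) / 2)) = (γ - σ) * ((1 + κ) / 2) := by ring
  have h4 : 0 < (γ - σ) * ((1 + κ) / 2) := by positivity
  have h5 : σ < γ - (γ - σ) * ((1 + κ) / 2) := by nlinarith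
  refine ⟨γ - (γ - σ) * ((1 + κ) / 2), ⟨hσ.1.trans h5, by linarith⟩, h5, ?_⟩
  have hr : 0 ≤ 2 / (1 + κ) := by positivity
  calc Γ (L₁ / (γ - (γ - σ) * ((1 + κ) / 2) - ρ), L₂ / (γ - (γ - (γ - σ) * ((1 + κ) / 2))))
      ≤ Γ (2 / (1 + κ) * (L₁ / (σ - ρ)), 2 / (1 + κ) * (L₂ / (γ - σ))) := by
        refine hΓ.mono (div_nonneg hL₁.le (by linarith)) ?_ (by rw [h3]; positivity) ?_
        · calc L₁ / (γ - (γ - σ) * ((1 + κ) / 2) - ρ) ≤ L₁ / (σ - ρ) := by gcongr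
            _ ≤ 2 / (1 + κ) * (L₁ / (σ - ρ)) := by
                refine le_mul_of_one_le_left (by positivity) ?_
                rw [le_div_iff₀ (by positivity)]
                linarith
        · rw [h3]
          refine le_of_eq ?_
          field_simp
    _ = 2 / (1 + κ) * κ := by rw [IsAdmissible.mul_eq hr]
    _ < 1 := by
        rw [div_mul_eq_mul_div, div_lt_one (by positivity)]
        linarith

section differentiability

variable [CompleteSpace X] (hQ : HasExponentialSplitting L Q M γ ρ)
  (hL : IsLinearEvolutionProcess L) (hΓ : IsAdmissible Γ) (hσ : σ ∈ Ioo ρ γ)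
  (hL₁ : 0 < L₁) (hL₂ : 0 < L₂) (hgap : Γ (L₁ / (σ - ρ), L₂ / (γ - σ)) < 1)
  (hf : IsLipNonlinearity L Q Γ γ ρ τ L₁ L₂ f)
  (hdiff : ∀ t : ℝ, Differentiable ℝ (f t))
  {φ : X → ℝ → X} (hφ : ∀ ξ, MemE L Q Γ γ ρ σ τ (φ ξ))
  (hφfix : ∀ ξ, ∀ t ≤ τ, lpMap L Q f τ ξ (φ ξ) t = φ ξ t)
  {η : X} (hD : IsLipNonlinearity L Q Γ γ ρ τ L₁ L₂ (fun s => fderiv ℝ (f s) (φ η s)))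
  {Z : ℝ → X →L[ℝ] X} (hZ : ∀ w, MemE L Q Γ γ ρ σ τ (fun t => Z t w))
  (hZfix : ∀ w, ∀ t ≤ τ,
    lpMap L Q (fun s => fderiv ℝ (f s) (φ η s)) τ w (fun t => Z t w) t = Z t w)

/-- The remainder of the first-order expansion of the nonlinearity along the solution family. -/
noncomputable def taylorRemainder (f : ℝ → X → X) (φ : X → ℝ → X) (η h : X) (s : ℝ) : X :=
  f s (φ (η + h) s) - f s (φ η s) - fderiv ℝ (f s) (φ η s) (φ (η + h) s - φ η s)

include hQ hL hΓ hσ hL₁ hL₂ hgap hf hφ hφfix hD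

/-- The increment of f and its linear part each obey the Lipschitz bounds, hence the factor 2. The
bound is linear in ‖h‖ and serves as the domination below. -/
lemma isForcing_taylorRemainder (h : X) :
    IsForcing L Q γ ρ σ τ
      (2 * L₁ * (Γ (M, M) * ‖h‖ / (1 - Γ (L₁ / (σ - ρ), L₂ / (γ - σ)))))
      (2 * L₂ * (Γ (M, M) * ‖h‖ / (1 - Γ (L₁ / (σ - ρ), L₂ / (γ - σ)))))
      (taylorRemainder f φ η h) := by
  have hK := isWeightBounded_fixedPoint_sub hQ hL hΓ hσ hf hL₁ hL₂ hgap (hφ (η + h)) (hφ η)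
    (hφfix (η + h)) (hφfix η)
  rw [add_sub_cancel_left] at hK
  have h1 := (hf.isForcing_sub hL₁ hL₂ (hφ (η + h)).1 (hφ η).1 hK).sub hQ
    (hD.isForcing hL₁ hL₂ ((hφ (η + h)).1.sub (hφ η).1) hK)
  rw [mul_assoc, mul_assoc, two_mul, two_mul]
  exact h1

include hdiff

omit hD in
-- Differentiability of f(s,·) at z_η(s) is composed with the Lipschitz dependence of z(s) on η; no
-- uniformity in s is claimed.
lemma taylorRemainder_isLittleO {s : ℝ} (hs : s ≤ τ) :
    (fun h => taylorRemainder f φ η h s) =o[𝓝 0] fun h : X => h := by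
  have hO : (fun h => φ (η + h) s - φ η s) =O[𝓝 0] fun h : X => h := by
    refine Asymptotics.IsBigO.of_bound
      (((Γ (1, 0))⁻¹ + (Γ (0, 1))⁻¹) * (Γ (M, M) / (1 - Γ (L₁ / (σ - ρ), L₂ / (γ - σ))))
          * Real.exp (σ * (τ - s))) (.of_forall fun h => ?_)
    have hK := isWeightBounded_fixedPoint_sub hQ hL hΓ hσ hf hL₁ hL₂ hgap (hφ (η + h)) (hφ η)
      (hφfix (η + h)) (hφfix η)
    rw [add_sub_cancel_left] at hK
    refine (hK.norm_le hQ hL hΓ hs).trans_eq ?_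
    ring
  have h1 := hasFDerivAt_iff_isLittleO_nhds_zero.1 (hdiff s (φ η s)).hasFDerivAt
  have h2 := h1.comp_tendsto (hO.trans_tendsto tendsto_id)
  refine (h2.congr_left fun h => ?_).trans_isBigO hO
  simp [taylorRemainder]

/-- Dominated convergence for the integrand divided by ‖h‖: it tends to 0 for each s, and the larger
exponent makes its majorant integrable. -/
lemma integral_taylorRemainder_isLittleO {σ' : ℝ} (hσ' : σ < σ') :
    (fun h => ∫ s in Iic τ, Real.exp (σ' * (s - τ)) * ‖taylorRemainder f φ η h s‖)
      =o[𝓝 0] fun h : X => h := by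
  rw [← Asymptotics.isLittleO_norm_right, Asymptotics.isLittleO_iff_tendsto]
  swap
  · intro h hh
    rw [norm_eq_zero] at hh
    simp [hh, taylorRemainder]
  set C := Γ (M, M) / (1 - Γ (L₁ / (σ - ρ), L₂ / (γ - σ))) with hC
  have hC0 : 0 ≤ C := div_nonneg (apply_nonneg Γ _) (by linarith)
  have hF := isForcing_taylorRemainder hQ hL hΓ hσ hL₁ hL₂ hgap hf hφ hφfix hD
  simp_rw [← integral_div]
  rw [← integral_zero ℝ ℝ (μ := volume.restrict (Iic τ))]
  refine tendsto_integral_filter_of_dominated_convergence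
    (fun s => (2 * L₁ * C + 2 * L₂ * C) *
      (Real.exp (σ * τ - σ' * τ) * Real.exp ((σ' - σ) * s))) ?_ ?_ ?_ ?_
  · exact .of_forall fun h => (((hF h).integrableOn_exp_mul_norm hQ hL hσ').div_const _).aestronglyMeasurable
  · refine .of_forall fun h => ?_
    filter_upwards [ae_restrict_mem measurableSet_Iic] with s hs
    rw [Real.norm_of_nonneg (by positivity), ← exp_weight]
    -- This form of the bound also covers h = 0, where the quotient is 0 by convention.
    refine div_le_of_le_mul₀ (norm_nonneg h) (by positivity) ?_
    refine (mul_le_mul_of_nonneg_left ((hF h).norm_le hQ hL hs) (Real.exp_pos _).le).trans_eq ?_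
    rw [hC]
    ring
  · exact integrableOn_weight_Iic hσ' _ _ τ
  · filter_upwards [ae_restrict_mem measurableSet_Iic] with s hs
    have h1 := (taylorRemainder_isLittleO hQ hL hΓ hσ hL₁ hL₂ hgap hf hdiff hφ hφfix
      (η := η) hs).norm_norm.tendsto_div_nhds_zero.const_mul (Real.exp (σ' * (s - τ)))
    simpa only [mul_div_assoc, mul_zero] using h1

include hZ hZfix

/-- The fixed point of the linearized map is the derivative of the solution. -/
lemma hasFDerivAt_fixedPoint {t : ℝ} (ht : t ≤ τ) :
    HasFDerivAt (fun ξ => φ ξ t) (Z t) η := by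
  obtain ⟨σ', hσ'mem, hσσ', hgap'⟩ := exists_larger_exponent hσ hΓ hL₁ hL₂ hgap
  rw [hasFDerivAt_iff_isLittleO_nhds_zero]
  refine Asymptotics.IsBigO.trans_isLittleO ?_ (integral_taylorRemainder_isLittleO hQ hL hΓ hσ
    hL₁ hL₂ hgap hf hdiff hφ hφfix hD hσσ')
  set κ := Γ (L₁ / (σ' - ρ), L₂ / (γ - σ'))
  refine Asymptotics.IsBigO.of_bound
    (((Γ (1, 0))⁻¹ + (Γ (0, 1))⁻¹) * (Γ (M, M) / (1 - κ)) * Real.exp (σ' * (τ - t)))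
    (.of_forall fun h => ?_)
  set I := ∫ s in Iic τ, Real.exp (σ' * (s - τ)) * ‖taylorRemainder f φ η h s‖ with hI
  have hI0 : 0 ≤ I := setIntegral_nonneg measurableSet_Iic fun s _ => by positivity
  rw [Real.norm_of_nonneg hI0]
  obtain ⟨hc₁, K₁, hK₁⟩ := memE_iff.1 (hφ (η + h))
  obtain ⟨hc₀, K₀, hK₀⟩ := memE_iff.1 (hφ η)
  obtain ⟨hcZ, K, hK⟩ := memE_iff.1 (hZ h)
  have hw : ContinuousOn (fun s => φ (η + h) s - φ η s - Z s h) (Iic τ) := (hc₁.sub hc₀).sub hcZ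
  have hwK := (hK₁.sub hQ hΓ hK₀).sub hQ hΓ hK
  have hF := isForcing_taylorRemainder hQ hL hΓ hσ hL₁ hL₂ hgap hf hφ hφfix hD h
  have hf₁ := hf.isForcing hL₁ hL₂ hc₁ hK₁
  have hf₀ := hf.isForcing hL₁ hL₂ hc₀ hK₀
  have hDZ := hD.isForcing hL₁ hL₂ hcZ hK
  have hDw := hD.isForcing hL₁ hL₂ hw hwK
  -- The homogeneous terms cancel, so the error solves the linearized equation with zero datum,
  -- forced by the Taylor remainder.
  have heq : ∀ r ≤ τ, φ (η + h) r - φ η r - Z r h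
      = lpForce L Q τ (fun s => fderiv ℝ (f s) (φ η s) (φ (η + h) s - φ η s - Z s h)) r
        + lpForce L Q τ (taylorRemainder f φ η h) r := by
    intro r hr
    rw [← hDw.lpForce_add hQ hL hσ hF hr]
    have h1 : (fun s => fderiv ℝ (f s) (φ η s) (φ (η + h) s - φ η s - Z s h)
        + taylorRemainder f φ η h s)
        = fun s => (f s (φ (η + h) s) - f s (φ η s)) - fderiv ℝ (f s) (φ η s) (Z s h) := by
      funext s
      rw [taylorRemainder, map_sub (fderiv ℝ (f s) (φ η s)) (φ (η + h) s - φ η s)]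
      abel
    rw [h1, (hf₁.sub hQ hf₀).lpForce_sub hQ hL hσ hDZ hr, hf₁.lpForce_sub hQ hL hσ hf₀ hr]
    have e1 := hφfix (η + h) r hr
    have e2 := hφfix η r hr
    have e3 := hZfix h r hr
    rw [lpMap_eq] at e1 e2 e3
    rw [← e1, ← e2, ← e3, map_add]
    abel
  -- The finite a priori bound at exponent σ carries over to σ', where the contraction replaces it
  -- by a multiple of the L¹ norm of the remainder.
  have hbound := (hwK.mono_exponent hσσ'.le).of_contraction (κ := κ) (D := Γ (M, M) * I) hgap'
    fun K' hK' => by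
      have h1 := (hD.isForcing hL₁ hL₂ hw hK').isWeightBounded_lpForce hQ hL hΓ hσ'mem hK'.nonneg
      have h2 : IsWeightBounded L Q Γ γ ρ σ' τ (Γ (M, M) * I)
          (lpForce L Q τ (taylorRemainder f φ η h)) := fun r hr =>
        (hF.mono_exponent hσσ'.le).movingNorm_lpForce_le_integral hQ hL hσ'mem hΓ
          (hF.integrableOn_exp_mul_norm hQ hL hσσ') hr
      exact (h1.add hQ hΓ h2).congr fun r hr => (heq r hr).symm
  refine (hbound.norm_le hQ hL hΓ ht).trans_eq ?_
  ring

end differentiability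

end InertialManifold

/-! ### Operator-valued solutions and strong integrals -/

namespace InertialManifold

open Filter Topology

variable {X : Type*} [NormedAddCommGroup X] [NormedSpace ℝ X]
  {L : ℝ → ℝ → X →L[ℝ] X} {Q : ℝ → X →L[ℝ] X} {M γ ρ : ℝ} {Γ : Seminorm ℝ (ℝ × ℝ)}
  {σ τ K L₁ L₂ : ℝ} {f : ℝ → X → X} {z : ℝ → X} {A Z Z' : ℝ → X →L[ℝ] X}

lemma weightedValues_nonempty : (weightedValues L Q Γ γ ρ σ τ Z).Nonempty :=
  ⟨_, τ, 0, le_rfl, by simp, rfl⟩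

/-- Homogeneity in w turns the supremum over the unit ball into vectorwise bounds, so statements
about F reduce to statements about E. The condition 0 ≤ K comes from w = 0. -/
lemma mem_upperBounds_weightedValues_iff :
    K ∈ upperBounds (weightedValues L Q Γ γ ρ σ τ Z) ↔
      0 ≤ K ∧ ∀ w, IsWeightBounded L Q Γ γ ρ σ τ (K * ‖w‖) (fun t => Z t w) := by
  have key : ∀ t w B, Real.exp (σ * (t - τ)) * movingNorm L Q Γ γ ρ t (Z t w) ≤ B ↔
      movingNorm L Q Γ γ ρ t (Z t w) ≤ B * Real.exp (σ * (τ - t)) := by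
    intro t w B
    rw [show σ * (τ - t) = -(σ * (t - τ)) by ring, Real.exp_neg, ← div_eq_mul_inv,
      le_div_iff₀ (Real.exp_pos _), mul_comm]
  constructor
  · refine fun h => ⟨?_, fun w t ht => ?_⟩
    · have := h ⟨τ, 0, le_rfl, by simp, rfl⟩
      simpa [movingNorm_zero] using this
    · rcases eq_or_ne w 0 with rfl | hw
      · simp [movingNorm_zero]
      have hw' : ‖w‖ ≠ 0 := norm_ne_zero_iff.2 hw
      have h1 := (key t (‖w‖⁻¹ • w) K).1 (h ⟨t, ‖w‖⁻¹ • w, ht, by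
        rw [norm_smul, norm_inv, norm_norm, inv_mul_cancel₀ hw'], rfl⟩)
      rw [map_smul, movingNorm_smul, abs_inv, abs_norm,
        inv_mul_le_iff₀ (norm_pos_iff.2 hw)] at h1
      refine h1.trans_eq ?_
      ring
  · rintro ⟨hK, h⟩ _ ⟨t, w, ht, hw, rfl⟩
    exact (key t w K).2 ((h w t ht).trans (by
      gcongr
      exact mul_le_of_le_one_right hK hw))

lemma memF_iff : MemF L Q Γ γ ρ σ τ Z ↔ (∀ w, ContinuousOn (fun t => Z t w) (Iic τ)) ∧
    ∃ K, 0 ≤ K ∧ ∀ w, IsWeightBounded L Q Γ γ ρ σ τ (K * ‖w‖) (fun t => Z t w) :=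
  and_congr_right fun _ => exists_congr fun _ => mem_upperBounds_weightedValues_iff

lemma MemF.memE (hZ : MemF L Q Γ γ ρ σ τ Z) (w : X) : MemE L Q Γ γ ρ σ τ (fun t => Z t w) := by
  obtain ⟨hc, K, -, hK⟩ := memF_iff.1 hZ
  exact memE_iff.2 ⟨hc w, _, hK w⟩

lemma MemF.sub (hQ : HasExponentialSplitting L Q M γ ρ) (hΓ : IsAdmissible Γ)
    (hZ : MemF L Q Γ γ ρ σ τ Z) (hZ' : MemF L Q Γ γ ρ σ τ Z') :
    MemF L Q Γ γ ρ σ τ (Z - Z') := by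
  rw [memF_iff] at hZ hZ' ⊢
  obtain ⟨hc, K, hK0, hK⟩ := hZ
  obtain ⟨hc', K', hK0', hK'⟩ := hZ'
  refine ⟨fun w => (hc w).sub (hc' w), K + K', add_nonneg hK0 hK0', fun w => ?_⟩
  rw [add_mul]
  exact (hK w).sub hQ hΓ (hK' w)

lemma normF_nonneg (hZ : MemF L Q Γ γ ρ σ τ Z) : 0 ≤ normF L Q Γ γ ρ σ τ Z :=
  (mem_upperBounds_weightedValues_iff.1 fun _ h => le_csSup hZ.2 h).1

lemma MemF.isWeightBounded (hZ : MemF L Q Γ γ ρ σ τ Z) (w : X) :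
    IsWeightBounded L Q Γ γ ρ σ τ (normF L Q Γ γ ρ σ τ Z * ‖w‖) (fun t => Z t w) :=
  (mem_upperBounds_weightedValues_iff.1 fun _ h => le_csSup hZ.2 h).2 w

lemma normF_le (hK : 0 ≤ K)
    (h : ∀ w, IsWeightBounded L Q Γ γ ρ σ τ (K * ‖w‖) (fun t => Z t w)) :
    normF L Q Γ γ ρ σ τ Z ≤ K :=
  csSup_le weightedValues_nonempty (mem_upperBounds_weightedValues_iff.2 ⟨hK, h⟩)

lemma exists_hasStrongIntegral {G : ℝ → X →L[ℝ] X} {I : Set ℝ}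
    (hG : ∀ w, IntegrableOn (fun s => G s w) I) {C : ℝ} (hC : ∀ w, ‖∫ s in I, G s w‖ ≤ C * ‖w‖) :
    ∃ B, HasStrongIntegral G I B :=
  ⟨LinearMap.mkContinuous
    { toFun := fun w => ∫ s in I, G s w
      map_add' := fun w w' => by simp only [map_add]; exact integral_add (hG w) (hG w')
      map_smul' := fun c w => by simp only [map_smul, integral_smul, RingHom.id_apply] } C hC,
    fun w => ⟨hG w, rfl⟩⟩

lemma strongIntegral_apply {G : ℝ → X →L[ℝ] X} {I : Set ℝ} (h : ∃ B, HasStrongIntegral G I B)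
    (w : X) : strongIntegral G I w = ∫ s in I, G s w := by
  rw [strongIntegral, dif_pos h]
  exact (h.choose_spec w).2.symm

section linearized

variable [CompleteSpace X] (hQ : HasExponentialSplitting L Q M γ ρ)
  (hL : IsLinearEvolutionProcess L) (hΓ : IsAdmissible Γ) (hσ : σ ∈ Ioo ρ γ)
  (hL₁ : 0 < L₁) (hL₂ : 0 < L₂)
  (hD : IsLipNonlinearity L Q Γ γ ρ τ L₁ L₂ (fun s => fderiv ℝ (f s) (z s)))
  (hZ : MemF L Q Γ γ ρ σ τ Z)
include hQ hL hΓ hσ hL₁ hL₂ hD hZ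

omit [CompleteSpace X] hQ hL hΓ hσ in
lemma MemF.isForcing (w : X) :
    IsForcing L Q γ ρ σ τ (L₁ * (normF L Q Γ γ ρ σ τ Z * ‖w‖))
      (L₂ * (normF L Q Γ γ ρ σ τ Z * ‖w‖)) (fun s => fderiv ℝ (f s) (z s) (Z s w)) :=
  hD.isForcing hL₁ hL₂ (hZ.1 w) (hZ.isWeightBounded w)

omit hΓ in
-- Up to sign the integral is the Q(t)-component of the force, whose estimate supplies a bound
-- linear in ‖w‖.
lemma exists_hasStrongIntegral_linUnstable {t : ℝ} (ht : t ≤ τ) :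
    ∃ B, HasStrongIntegral (linUnstable L Q f z Z t) (Ioc t τ) B := by
  have hF := hZ.isForcing hL₁ hL₂ hD
  refine exists_hasStrongIntegral (fun w => (hF w).integrableOn_unstable hQ hL hσ t)
    (C := L₁ * normF L Q Γ γ ρ σ τ Z / (σ - ρ) * Real.exp (σ * (τ - t))) fun w => ?_
  have h1 := (norm_proj_le_normN hQ hL t _).trans ((hF w).normN_lpForce_le hQ hL hσ ht)
  rw [(hF w).proj_lpForce hQ hL hσ ht, norm_neg] at h1
  refine h1.trans_eq ?_
  ring

omit hΓ in
lemma exists_hasStrongIntegral_linStable {t : ℝ} (ht : t ≤ τ) :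
    ∃ B, HasStrongIntegral (linStable L Q f z Z t) (Iic t) B := by
  have hF := hZ.isForcing hL₁ hL₂ hD
  refine exists_hasStrongIntegral (fun w => (hF w).integrableOn_stable hQ hL hσ ht)
    (C := L₂ * normF L Q Γ γ ρ σ τ Z / (γ - σ) * Real.exp (σ * (τ - t))) fun w => ?_
  have h1 := (norm_complProj_le_normS hQ hL t _).trans ((hF w).normS_lpForce_le hQ hL hσ ht)
  rw [(hF w).complProj_lpForce hQ hL hσ ht] at h1
  refine h1.trans_eq ?_
  ring

omit hΓ in
-- Evaluated at w, the operator equation is the Lyapunov–Perron equation with nonlinearity u ↦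
-- Df(s,z(s))u and datum w.
lemma linearizedMap_apply {t : ℝ} (ht : t ≤ τ) (w : X) :
    linearizedMap L Q f τ z Z t w
      = lpMap L Q (fun s => fderiv ℝ (f s) (z s)) τ w (fun s => Z s w) t := by
  change unstableOp L Q t τ w - strongIntegral (linUnstable L Q f z Z t) (Ioc t τ) w
    + strongIntegral (linStable L Q f z Z t) (Iic t) w = _
  rw [strongIntegral_apply (exists_hasStrongIntegral_linUnstable hQ hL hσ hL₁ hL₂ hD hZ ht),
    strongIntegral_apply (exists_hasStrongIntegral_linStable hQ hL hσ hL₁ hL₂ hD hZ ht)]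
  rfl

lemma memF_linearizedMap : MemF L Q Γ γ ρ σ τ (linearizedMap L Q f τ z Z) := by
  have happ := fun w : X => fun t (ht : t ∈ Iic τ) =>
    linearizedMap_apply hQ hL hσ hL₁ hL₂ hD hZ ht w
  refine memF_iff.2 ⟨fun w =>
    (memE_lpMap hQ hL hΓ hσ hD hL₁ hL₂ w (hZ.memE w)).1.congr (happ w),
    Γ (M, M) + Γ (L₁ / (σ - ρ), L₂ / (γ - σ)) * normF L Q Γ γ ρ σ τ Z,
    add_nonneg (apply_nonneg Γ _) (mul_nonneg (apply_nonneg Γ _) (normF_nonneg hZ)),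
    fun w => ?_⟩
  -- Comparison with the zero curve for the datum 0 turns the difference estimate into a bound.
  have h1 := isWeightBounded_lpMap_sub hQ hL hΓ hσ hD hL₁ hL₂ w 0 (hZ.memE w) memE_zero
    (K := normF L Q Γ γ ρ σ τ Z * ‖w‖) (by simpa using hZ.isWeightBounded w)
  simp only [lpMap_zero, sub_zero] at h1
  rw [add_mul, mul_assoc (Γ (L₁ / (σ - ρ), L₂ / (γ - σ)))]
  exact h1.congr fun t ht => (happ w t ht).symm

lemma normF_linearizedMap_sub_le (hZ' : MemF L Q Γ γ ρ σ τ Z') :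
    normF L Q Γ γ ρ σ τ (linearizedMap L Q f τ z Z - linearizedMap L Q f τ z Z')
      ≤ Γ (L₁ / (σ - ρ), L₂ / (γ - σ)) * normF L Q Γ γ ρ σ τ (Z - Z') := by
  have hsub := hZ.sub hQ hΓ hZ'
  refine normF_le (mul_nonneg (apply_nonneg Γ _) (normF_nonneg hsub)) fun w => ?_
  have h1 := isWeightBounded_lpMap_sub hQ hL hΓ hσ hD hL₁ hL₂ w w (hZ.memE w) (hZ'.memE w)
    (hsub.isWeightBounded w)
  rw [sub_self, norm_zero, mul_zero, zero_add, ← mul_assoc] at h1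
  refine h1.congr fun t ht => ?_
  change _ = linearizedMap L Q f τ z Z t w - linearizedMap L Q f τ z Z' t w
  rw [linearizedMap_apply hQ hL hσ hL₁ hL₂ hD hZ ht,
    linearizedMap_apply hQ hL hσ hL₁ hL₂ hD hZ' ht]

lemma linearizedMap_fixedPoint_unique (hgap : Γ (L₁ / (σ - ρ), L₂ / (γ - σ)) < 1)
    (hZ' : MemF L Q Γ γ ρ σ τ Z')
    (hfix : ∀ t ≤ τ, linearizedMap L Q f τ z Z t = Z t)
    (hfix' : ∀ t ≤ τ, linearizedMap L Q f τ z Z' t = Z' t) : EqOn Z Z' (Iic τ) := by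
  intro t ht
  ext w
  refine fixedPoint_unique hQ hL hΓ hσ hD hL₁ hL₂ hgap (hZ.memE w) (hZ'.memE w) (η := w)
    (fun s hs => ?_) (fun s hs => ?_) ht
  · rw [← linearizedMap_apply hQ hL hσ hL₁ hL₂ hD hZ hs, hfix s hs]
  · rw [← linearizedMap_apply hQ hL hσ hL₁ hL₂ hD hZ' hs, hfix' s hs]

end linearized

/-! ### The solution family, its derivative and Σ -/

section solution

variable [CompleteSpace X] (hQ : HasExponentialSplitting L Q M γ ρ)
  (hL : IsLinearEvolutionProcess L) (hΓ : IsAdmissible Γ) (hσ : σ ∈ Ioo ρ γ)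
  (hL₁ : 0 < L₁) (hL₂ : 0 < L₂) (hgap : Γ (L₁ / (σ - ρ), L₂ / (γ - σ)) < 1)
  (hf : IsLipNonlinearity L Q Γ γ ρ τ L₁ L₂ f)
include hQ hL hΓ hσ hL₁ hL₂ hgap hf

lemma isLPFixedPoint_lpSol (η : X) :
    IsLPFixedPoint L Q Γ f γ ρ σ τ η (lpSol L Q Γ f γ ρ σ τ η) :=
  Classical.epsilon_spec (exists_fixedPoint hQ hL hΓ hσ hf hL₁ hL₂ hgap η)

lemma integrableOn_stable_lpSol (η : X) :
    IntegrableOn (fun s => L τ s (complProj Q s (f s (lpSol L Q Γ f γ ρ σ τ η s)))) (Iic τ) := by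
  obtain ⟨hc, K, hK⟩ := memE_iff.1 (isLPFixedPoint_lpSol hQ hL hΓ hσ hL₁ hL₂ hgap hf η).1
  exact (hf.isForcing hL₁ hL₂ hc hK).integrableOn_stable hQ hL hσ le_rfl

lemma sigmaMap_eq (η : X) : sigmaMap L Q Γ f γ ρ σ τ η
    = ∫ s in Iic τ, L τ s (complProj Q s (f s (lpSol L Q Γ f γ ρ σ τ η s))) := by
  have hfix := isLPFixedPoint_lpSol hQ hL hΓ hσ hL₁ hL₂ hgap hf η
  obtain ⟨hc, K, hK⟩ := memE_iff.1 hfix.1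
  rw [sigmaMap, ← hfix.2 τ le_rfl, lpMap_eq, map_add, hQ.complProj_unstableOp hL le_rfl, zero_add,
    (hf.isForcing hL₁ hL₂ hc hK).complProj_lpForce hQ hL hσ le_rfl]

variable {η : X} (hdiff : ∀ t : ℝ, Differentiable ℝ (f t))
  (hD : IsLipNonlinearity L Q Γ γ ρ τ L₁ L₂
    (fun s => fderiv ℝ (f s) (lpSol L Q Γ f γ ρ σ τ η s)))
include hdiff hD

/-- One operator family is both a fixed point in F and the derivative; the properties of D_η z are
read off from it on (-∞,τ]. -/
lemma exists_derivative_lpSol :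
    ∃ Z : ℝ → X →L[ℝ] X, MemF L Q Γ γ ρ σ τ Z ∧
      (∀ t ≤ τ, linearizedMap L Q f τ (lpSol L Q Γ f γ ρ σ τ η) Z t = Z t) ∧
      ∀ t ≤ τ, HasFDerivAt (fun ξ => lpSol L Q Γ f γ ρ σ τ ξ t) (Z t) η := by
  have hsol := isLPFixedPoint_lpSol hQ hL hΓ hσ hL₁ hL₂ hgap hf
  obtain ⟨Z, hZ⟩ := exists_operator_fixedPoint hQ hL hΓ hσ hL₁ hL₂ hD hgap
  have hZF : MemF L Q Γ γ ρ σ τ Z := by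
    refine memF_iff.2 ⟨fun w => (hZ w).1.1,
      Γ (M, M) / (1 - Γ (L₁ / (σ - ρ), L₂ / (γ - σ))),
      div_nonneg (apply_nonneg Γ _) (by linarith), fun w => ?_⟩
    rw [div_mul_eq_mul_div]
    exact (hZ w).2.2
  refine ⟨Z, hZF, fun t ht => ?_, fun t ht => ?_⟩
  · ext w
    rw [linearizedMap_apply hQ hL hσ hL₁ hL₂ hD hZF ht, (hZ w).2.1 t ht]
  · exact hasFDerivAt_fixedPoint hQ hL hΓ hσ hL₁ hL₂ hgap hf hdiff (fun ξ => (hsol ξ).1)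
      (fun ξ => (hsol ξ).2) hD (fun w => (hZ w).1) (fun w => (hZ w).2.1) ht

lemma differentiableAt_lpSol {t : ℝ} (ht : t ≤ τ) :
    DifferentiableAt ℝ (fun ξ => lpSol L Q Γ f γ ρ σ τ ξ t) η := by
  obtain ⟨Z, -, -, hZ⟩ := exists_derivative_lpSol hQ hL hΓ hσ hL₁ hL₂ hgap hf hdiff hD
  exact (hZ t ht).differentiableAt

lemma memF_fderiv_lpSol :
    MemF L Q Γ γ ρ σ τ (fun t => fderiv ℝ (fun ξ => lpSol L Q Γ f γ ρ σ τ ξ t) η) := by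
  obtain ⟨Z, hZF, -, hZ⟩ := exists_derivative_lpSol hQ hL hΓ hσ hL₁ hL₂ hgap hf hdiff hD
  obtain ⟨hc, K, hK0, hK⟩ := memF_iff.1 hZF
  have heq : ∀ w, EqOn (fun t => Z t w)
      (fun t => fderiv ℝ (fun ξ => lpSol L Q Γ f γ ρ σ τ ξ t) η w) (Iic τ) := fun w t ht => by
    simp only [(hZ t ht).fderiv]
  exact memF_iff.2 ⟨fun w => (hc w).congr (heq w).symm, K, hK0, fun w => (hK w).congr (heq w)⟩

lemma linearizedMap_fderiv_lpSol {t : ℝ} (ht : t ≤ τ) :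
    linearizedMap L Q f τ (lpSol L Q Γ f γ ρ σ τ η)
        (fun s => fderiv ℝ (fun ξ => lpSol L Q Γ f γ ρ σ τ ξ s) η) t
      = fderiv ℝ (fun ξ => lpSol L Q Γ f γ ρ σ τ ξ t) η := by
  obtain ⟨Z, hZF, hfix, hZ⟩ := exists_derivative_lpSol hQ hL hΓ hσ hL₁ hL₂ hgap hf hdiff hD
  rw [(hZ t ht).fderiv, ← hfix t ht]
  ext w
  rw [linearizedMap_apply hQ hL hσ hL₁ hL₂ hD
    (memF_fderiv_lpSol hQ hL hΓ hσ hL₁ hL₂ hgap hf hdiff hD) ht,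
    linearizedMap_apply hQ hL hσ hL₁ hL₂ hD hZF ht]
  exact lpMap_congr w (fun s hs => by simp only [(hZ s hs).fderiv]) ht

lemma hasFDerivAt_sigmaMap :
    HasFDerivAt (sigmaMap L Q Γ f γ ρ σ τ)
      (complProj Q τ ∘L fderiv ℝ (fun ξ => lpSol L Q Γ f γ ρ σ τ ξ τ) η) η :=
  (complProj Q τ).hasFDerivAt.comp η (differentiableAt_lpSol hQ hL hΓ hσ hL₁ hL₂ hgap hf hdiff hD
    le_rfl).hasFDerivAt

/-- DΣ = (I - Q(τ))D_η z(τ). Applying I - Q(τ) to the linearized equation at t = τ leaves only its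
stable integral. -/
lemma hasStrongIntegral_fderiv_sigmaMap :
    HasStrongIntegral
      (linStable L Q f (lpSol L Q Γ f γ ρ σ τ η)
        (fun s => fderiv ℝ (fun ξ => lpSol L Q Γ f γ ρ σ τ ξ s) η) τ)
      (Iic τ) (fderiv ℝ (sigmaMap L Q Γ f γ ρ σ τ) η) := by
  have hF := memF_fderiv_lpSol hQ hL hΓ hσ hL₁ hL₂ hgap hf hdiff hD
  have hg := hF.isForcing hL₁ hL₂ hD
  refine fun w => ⟨(hg w).integrableOn_stable hQ hL hσ le_rfl, ?_⟩
  rw [(hasFDerivAt_sigmaMap hQ hL hΓ hσ hL₁ hL₂ hgap hf hdiff hD).fderiv,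
    ← linearizedMap_fderiv_lpSol hQ hL hΓ hσ hL₁ hL₂ hgap hf hdiff hD le_rfl,
    ContinuousLinearMap.comp_apply,
    linearizedMap_apply hQ hL hσ hL₁ hL₂ hD hF le_rfl, lpMap_eq, map_add,
    hQ.complProj_unstableOp hL le_rfl, zero_add, (hg w).complProj_lpForce hQ hL hσ le_rfl]
  rfl

end solution

end InertialManifold

/-! ### The theorem -/

open InertialManifold in
theorem theorem5p1 {X : Type*} [NormedAddCommGroup X] [NormedSpace ℝ X] [CompleteSpace X]
    (L : ℝ → ℝ → X →L[ℝ] X) (Q : ℝ → X →L[ℝ] X) (M γ ρ : ℝ)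
    (hL : IsLinearEvolutionProcess L) (hQ : HasExponentialSplitting L Q M γ ρ)
    (Γ : Seminorm ℝ (ℝ × ℝ)) (hΓ : IsAdmissible Γ)
    (f : ℝ → X → X) (hf : Continuous fun p : ℝ × X => f p.1 p.2)
    (hf0 : ∀ t : ℝ, f t 0 = 0)
    (L₁ L₂ : ℝ) (hL₁ : 0 < L₁) (hL₂ : 0 < L₂)
    (hLip₁ : ∀ (t : ℝ) (u v : X),
      normN L Q ρ t (Q t (f t u - f t v)) ≤ L₁ * movingNorm L Q Γ γ ρ t (u - v))
    (hLip₂ : ∀ (t : ℝ) (u v : X),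
      normS L γ t (complProj Q t (f t u - f t v)) ≤ L₂ * movingNorm L Q Γ γ ρ t (u - v))
    (σ : ℝ) (hσ : σ ∈ Set.Ioo ρ γ)
    (hgap : Γ (L₁ / (σ - ρ), L₂ / (γ - σ)) < 1)
    (hdiff : ∀ t : ℝ, Differentiable ℝ (f t)) :
    -- the fixed points `z_{τ,η}`, and hence `Σ`, are well defined
    (∀ (τ : ℝ) (η : X),
      (∃ z : ℝ → X, IsLPFixedPoint L Q Γ f γ ρ σ τ η z) ∧
      ∀ z z' : ℝ → X, IsLPFixedPoint L Q Γ f γ ρ σ τ η z →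
        IsLPFixedPoint L Q Γ f γ ρ σ τ η z' → Set.EqOn z z' (Set.Iic τ)) ∧
    (∀ (τ : ℝ) (η : X),
      MeasureTheory.IntegrableOn
        (fun s => L τ s (complProj Q s (f s (lpSol L Q Γ f γ ρ σ τ η s)))) (Set.Iic τ) ∧
      sigmaMap L Q Γ f γ ρ σ τ η =
        ∫ s in Set.Iic τ, L τ s (complProj Q s (f s (lpSol L Q Γ f γ ρ σ τ η s)))) ∧
    -- differentiability of `Σ(τ,·)` and the formula for the derivative
    (∀ τ : ℝ, Differentiable ℝ (sigmaMap L Q Γ f γ ρ σ τ)) ∧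
    (∀ τ : ℝ, ∀ t ≤ τ, Differentiable ℝ (fun ξ : X => lpSol L Q Γ f γ ρ σ τ ξ t)) ∧
    (∀ (τ : ℝ) (η : X),
      HasStrongIntegral
        (fun s => (L τ s) ∘L (complProj Q s) ∘L
          (fderiv ℝ (f s) (lpSol L Q Γ f γ ρ σ τ η s)) ∘L
          (fderiv ℝ (fun ξ : X => lpSol L Q Γ f γ ρ σ τ ξ s) η))
        (Set.Iic τ)
        (fderiv ℝ (sigmaMap L Q Γ f γ ρ σ τ) η)) ∧
    -- the linearized map is a contraction of `F_σ` into itself, all of its integrals exist, and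
    -- its unique fixed point is the derivative of `z_{τ,η}` with respect to `η`
    (∀ (τ : ℝ) (η : X),
      (∀ Z : ℝ → X →L[ℝ] X, MemF L Q Γ γ ρ σ τ Z →
        (∀ t ≤ τ,
          (∃ A, HasStrongIntegral
            (linUnstable L Q f (lpSol L Q Γ f γ ρ σ τ η) Z t) (Set.Ioc t τ) A) ∧
          (∃ A, HasStrongIntegral
            (linStable L Q f (lpSol L Q Γ f γ ρ σ τ η) Z t) (Set.Iic t) A)) ∧
        MemF L Q Γ γ ρ σ τ (linearizedMap L Q f τ (lpSol L Q Γ f γ ρ σ τ η) Z)) ∧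
      (∀ Z Z' : ℝ → X →L[ℝ] X, MemF L Q Γ γ ρ σ τ Z → MemF L Q Γ γ ρ σ τ Z' →
        normF L Q Γ γ ρ σ τ
            (linearizedMap L Q f τ (lpSol L Q Γ f γ ρ σ τ η) Z
              - linearizedMap L Q f τ (lpSol L Q Γ f γ ρ σ τ η) Z')
          ≤ Γ (L₁ / (σ - ρ), L₂ / (γ - σ)) * normF L Q Γ γ ρ σ τ (Z - Z')) ∧
      MemF L Q Γ γ ρ σ τ (fun t => fderiv ℝ (fun ξ : X => lpSol L Q Γ f γ ρ σ τ ξ t) η) ∧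
      (∀ t ≤ τ,
        linearizedMap L Q f τ (lpSol L Q Γ f γ ρ σ τ η)
            (fun s => fderiv ℝ (fun ξ : X => lpSol L Q Γ f γ ρ σ τ ξ s) η) t
          = fderiv ℝ (fun ξ : X => lpSol L Q Γ f γ ρ σ τ ξ t) η) ∧
      (∀ Z : ℝ → X →L[ℝ] X, MemF L Q Γ γ ρ σ τ Z →
        (∀ t ≤ τ, linearizedMap L Q f τ (lpSol L Q Γ f γ ρ σ τ η) Z t = Z t) →
        ∀ t ≤ τ, Z t = fderiv ℝ (fun ξ : X => lpSol L Q Γ f γ ρ σ τ ξ t) η)) := by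
  have hf' : ∀ τ, IsLipNonlinearity L Q Γ γ ρ τ L₁ L₂ f := fun τ =>
    isLipNonlinearity hf hLip₁ hLip₂ hf0
  have hsol := fun τ => isLPFixedPoint_lpSol hQ hL hΓ hσ hL₁ hL₂ hgap (hf' τ)
  have hD := fun τ η => isLipNonlinearity_fderiv hf hLip₁ hLip₂ hQ hdiff (hsol τ η).1.1
  have hmem := fun τ η => memF_fderiv_lpSol hQ hL hΓ hσ hL₁ hL₂ hgap (hf' τ) hdiff (hD τ η)
  have hfix := fun τ η t (ht : t ≤ τ) =>
    linearizedMap_fderiv_lpSol hQ hL hΓ hσ hL₁ hL₂ hgap (hf' τ) hdiff (hD τ η) ht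
  refine ⟨fun τ η => ⟨⟨_, hsol τ η⟩, fun z z' hz hz' => ?_⟩, fun τ η => ⟨?_, ?_⟩,
    fun τ η => ?_, fun τ t ht η => ?_, fun τ η => ?_, fun τ η => ⟨fun Z hZ => ⟨fun t ht => ⟨?_, ?_⟩,
      ?_⟩, fun Z Z' hZ hZ' => ?_, hmem τ η, hfix τ η, fun Z hZ hZfix => ?_⟩⟩
  · exact fixedPoint_unique hQ hL hΓ hσ (hf' τ) hL₁ hL₂ hgap hz.1 hz'.1 hz.2 hz'.2
  · exact integrableOn_stable_lpSol hQ hL hΓ hσ hL₁ hL₂ hgap (hf' τ) η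
  · exact sigmaMap_eq hQ hL hΓ hσ hL₁ hL₂ hgap (hf' τ) η
  · exact (hasFDerivAt_sigmaMap hQ hL hΓ hσ hL₁ hL₂ hgap (hf' τ) hdiff
      (hD τ η)).differentiableAt
  · exact differentiableAt_lpSol hQ hL hΓ hσ hL₁ hL₂ hgap (hf' τ) hdiff (hD τ η) ht
  · exact hasStrongIntegral_fderiv_sigmaMap hQ hL hΓ hσ hL₁ hL₂ hgap (hf' τ) hdiff (hD τ η)
  · exact exists_hasStrongIntegral_linUnstable hQ hL hσ hL₁ hL₂ (hD τ η) hZ ht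
  · exact exists_hasStrongIntegral_linStable hQ hL hσ hL₁ hL₂ (hD τ η) hZ ht
  · exact memF_linearizedMap hQ hL hΓ hσ hL₁ hL₂ (hD τ η) hZ
  · exact normF_linearizedMap_sub_le hQ hL hΓ hσ hL₁ hL₂ (hD τ η) hZ hZ'
  · exact linearizedMap_fixedPoint_unique hQ hL hΓ hσ hL₁ hL₂ (hD τ η) hZ hgap (hmem τ η)
      hZfix (hfix τ η)
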